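/- For each $d\in\{5,6,7,8\}$ there is an integer $v_0$ such that for every integer $v\ge v_0$ there exists a bipartite $d$-regular multigraph with node sets $V$ and $W$, $|V|=|W|=v$ (parallel edges are allowed, each edge joins a node of $V$ to a node of $W$, and every node is incident with exactly $d$ edges), such that for every $U\subseteq V$ and every $U\subseteq W$ the number of distinct nodes adjacent to at least one node of $U$ is at least $f_d(|U|)$, where \[ f_5(u)=\begin{cases} 2u & 0\le u\le 3v/20,\\ 4u/3+v/10 & 3v/20\le u\le 3v/10,\\ u+v/5 & 3v/10\le u\le v/2,\\ 3u/4+13v/40 & v/2\le u\le 7v/10,\\ u/2+v/2 & 7v/10\le u\le v, \end{cases} \qquad f_6(u)=\begin{cases} 5u/2 & 0\le u\le v/10,\\ 5u/3+v/12 & v/10\le u\le v/4,\\ u+v/4 & v/4\le u\le v/2,\\ 3u/5+9v/20 & v/2\le u\le 3v/4,\\ 2u/5+3v/5 & 3v/4\le u\le v, \end{cases} \] \[ f_7(u)=\begin{cases} 3u & 0\le u\le v/10,\\ 2u+v/10 & v/10\le u\le 3v/20,\\ 21u/15+19v/100 & 3v/20\le u\le 3v/10,\\ u+31v/100 & 3v/10\le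 u\le 39v/100,\\ 15u/21+59v/140 & 39v/100\le u\le 3v/5,\\ u/2+11v/20 & 3v/5\le u\le 7v/10,\\ u/3+2v/3 & 7v/10\le u\le v, \end{cases} \qquad f_8(u)=\begin{cases} 3u & 0\le u\le v/10,\\ 2u+v/10 & v/10\le u\le v/5,\\ 5u/4+v/4 & v/5\le u\le v/3,\\ 4u/5+2v/5 & v/3\le u\le v/2,\\ u/2+11v/20 & v/2\le u\le 7v/10,\\ u/3+2v/3 & 7v/10\le u\le v. \end{cases} \] -/

import Mathlib

namespace BipartiteExpander

/-- The degree of a vertex of a multigraph: the number of edges incident with it, counted with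
multiplicity, every loop counting twice. -/
noncomputable def degree {α β : Type*} (G : Graph α β) (x : α) : ℕ∞ :=
  (G.incidenceSet x).encard + (G.loopSet x).encard

/-- Every vertex of the multigraph `G` has degree `d`. -/
def IsRegular {α β : Type*} (G : Graph α β) (d : ℕ) : Prop :=
  ∀ x ∈ G.vertexSet, degree G x = d

/-- `G` is bipartite with node sets `V` and `W`: these partition the vertex set, and every edge
joins a vertex of `V` to a vertex of `W`. -/
structure IsBipartiteWith {α β : Type*} (G : Graph α β) (V W : Finset α) : Prop where
  disjoint : Disjoint V W
  vertexSet_eq : G.vertexSet = (V : Set α) ∪ (W : Set α)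
  edge_between : ∀ ⦃e x y⦄, G.IsLink e x y → (x ∈ V ∧ y ∈ W) ∨ (x ∈ W ∧ y ∈ V)

/-- The set of neighbours of `U`: all vertices adjacent to some vertex in `U`. -/
def neighbours {α β : Type*} (G : Graph α β) (U : Finset α) : Set α :=
  {y | ∃ x ∈ U, G.Adj x y}

noncomputable def f5 (v u : ℝ) : ℝ :=
  if u ≤ 3 * v / 20 then 2 * u
  else if u ≤ 3 * v / 10 then 4 * u / 3 + v / 10
  else if u ≤ v / 2 then u + v / 5
  else if u ≤ 7 * v / 10 then 3 * u / 4 + 13 * v / 40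
  else u / 2 + v / 2

noncomputable def f6 (v u : ℝ) : ℝ :=
  if u ≤ v / 10 then 5 * u / 2
  else if u ≤ v / 4 then 5 * u / 3 + v / 12
  else if u ≤ v / 2 then u + v / 4
  else if u ≤ 3 * v / 4 then 3 * u / 5 + 9 * v / 20
  else 2 * u / 5 + 3 * v / 5

noncomputable def f7 (v u : ℝ) : ℝ :=
  if u ≤ v / 10 then 3 * u
  else if u ≤ 3 * v / 20 then 2 * u + v / 10
  else if u ≤ 3 * v / 10 then 21 * u / 15 + 19 * v / 100
  else if u ≤ 39 * v / 100 then u + 31 * v / 100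
  else if u ≤ 3 * v / 5 then 15 * u / 21 + 59 * v / 140
  else if u ≤ 7 * v / 10 then u / 2 + 11 * v / 20
  else u / 3 + 2 * v / 3

noncomputable def f8 (v u : ℝ) : ℝ :=
  if u ≤ v / 10 then 3 * u
  else if u ≤ v / 5 then 2 * u + v / 10
  else if u ≤ v / 3 then 5 * u / 4 + v / 4
  else if u ≤ v / 2 then 4 * u / 5 + 2 * v / 5
  else if u ≤ 7 * v / 10 then u / 2 + 11 * v / 20
  else u / 3 + 2 * v / 3

/-- The bound `f_d(u)` for sides of size `v`; only `d = 5, 6, 7, 8` are meaningful, and there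
only `0 ≤ u ≤ v`. -/
noncomputable def f (d : ℕ) (v u : ℝ) : ℝ :=
  match d with
  | 5 => f5 v u
  | 6 => f6 v u
  | 7 => f7 v u
  | 8 => f8 v u
  | _ => 0

end BipartiteExpander

namespace BipartiteExpander

open Finset

/-! ### Permutations mapping one set into another -/

section Counting

variable {α : Type*} [Fintype α] [DecidableEq α]

/-! The graph is found at random. A permutation `σ` of `Fin v × Fin d` glues the half-edges of two
copies of `Fin v`, giving a `d`-regular bipartite multigraph (`permGraph`) whose two sides are
exchanged by passing to `σ⁻¹`. A set of size `u` fails to expand only if its `d * u` half-edges all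
land in some set of size `w`, which has probability `(d * w).choose (d * u) / (d * v).choose (d *
u)`. If the union bound over all such pairs is below `1 / 2`, some `σ` is good in both directions.

With `x = u / v` and `y` close to `w / v`, entropy estimates bound the expected number of bad pairs
by a polynomial in `v` times `exp (v * rate d x y)` (`expected_pairs_le`). Along each linear piece
of the profile used in the estimate the rate is convex, so only breakpoints matter, and there its
negativity is an inequality between integers (`rate_neg`). Near zero the rate itself tends to zero,
but like a multiple of `x * log x`, which still gives negative powers of `v` (`rate_le_near_zero`).
`exists_perm_of_rate` combines these estimates.

The estimate is needed only up to a cutoff `x₁`. The graph of each profile is invariant under `(x,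
y) ↦ (1 - y, 1 - x)`. If a large `A` has too few neighbours, the complement of its neighbourhood is
a set on the other side whose neighbours avoid `A`; it, or a subset of it, violates the bound
already proved (`le_card_permNeighbours_of_dual`). -/

/-- All sets of the cardinality of `A` are equally often the image of `A` under a permutation. -/
theorem card_perm_map_eq_mul_choose (A S : Finset α) (h : #S = #A) :
    #{σ : Equiv.Perm α | A.map σ.toEmbedding = S} * (Fintype.card α).choose #A
      = (Fintype.card α).factorial := by
  have key : ∀ T ∈ powersetCard #A (univ : Finset α),
      #{σ : Equiv.Perm α | A.map σ.toEmbedding = T}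
        = #{σ : Equiv.Perm α | A.map σ.toEmbedding = S} := by
    intro T hT
    have hT' : #T = #S := by rw [(mem_powersetCard.1 hT).2, h]
    obtain ⟨τ, hτ⟩ : ∃ τ : Equiv.Perm α, T.map τ.toEmbedding = S := by
      let e : {x // x ∈ T} ≃ {x // x ∈ S} := Finset.equivOfCardEq hT'
      refine ⟨e.extendSubtype, eq_of_subset_of_card_le ?_ (by simp [hT'])⟩
      intro y hy
      obtain ⟨x, hx, rfl⟩ := mem_map.1 hy
      exact e.extendSubtype_mem x hx
    -- Left multiplication by `τ` matches the two fibres, so all fibres of the image map have the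
    -- same size.
    refine card_bij' (fun σ _ => τ * σ) (fun σ _ => τ⁻¹ * σ) ?_ ?_ ?_ ?_
    · intro σ hσ
      simp only [mem_filter, mem_univ, true_and] at hσ ⊢
      rw [← hτ, ← hσ, map_map]; rfl
    · intro σ hσ
      simp only [mem_filter, mem_univ, true_and] at hσ ⊢
      have : A.map (τ⁻¹ * σ).toEmbedding = (A.map σ.toEmbedding).map (τ⁻¹).toEmbedding := by
        rw [map_map]; rfl
      rw [this, hσ, ← hτ, map_map]
      ext x
      simp
    · intro σ _; simp
    · intro σ _; simp
  have hsum := card_eq_sum_card_fiberwise (s := (univ : Finset (Equiv.Perm α)))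
    (f := fun σ => A.map σ.toEmbedding) (t := powersetCard #A (univ : Finset α))
    (by intro σ _; simp [mem_powersetCard])
  rw [sum_congr rfl key, sum_const, card_powersetCard, card_univ, Fintype.card_perm,
    card_univ, smul_eq_mul, mul_comm] at hsum
  exact hsum.symm

/-- The number of permutations mapping `A` into `B`. -/
theorem card_perm_mapsTo_mul_choose (A B : Finset α) :
    #{σ : Equiv.Perm α | ∀ a ∈ A, σ a ∈ B} * (Fintype.card α).choose #A
      = (Fintype.card α).factorial * (#B).choose #A := by
  -- Sort by the image of `A`: each subset of `B` of size `#A` is hit equally often.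
  have hsum := card_eq_sum_card_fiberwise
    (s := (univ.filter fun σ : Equiv.Perm α => ∀ a ∈ A, σ a ∈ B))
    (f := fun σ => A.map σ.toEmbedding) (t := powersetCard #A B)
    (by
      intro σ hσ
      simp only [coe_filter, mem_univ, true_and, Set.mem_ofPred_eq] at hσ
      simp only [mem_coe, mem_powersetCard, card_map, and_true]
      intro y hy
      obtain ⟨x, hx, rfl⟩ := mem_map.1 hy
      exact hσ x hx)
  rw [hsum, sum_mul, ← card_powersetCard #A B, mul_comm, ← smul_eq_mul, ← sum_const]
  refine sum_congr rfl fun S hS => ?_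
  obtain ⟨hSB, hS⟩ := mem_powersetCard.1 hS
  rw [← card_perm_map_eq_mul_choose A S hS, filter_filter]
  congr 2
  refine filter_congr fun σ _ => ⟨fun h => h.2, fun h => ⟨fun a ha => hSB ?_, h⟩⟩
  rw [← h]
  exact mem_map_of_mem _ ha

end Counting

/-! ### The bipartite multigraph of a permutation -/

section PermGraph

variable {v d : ℕ}

/-- The right ends of the edges with left end in `A`, where the edge `e` joins `e.1` to
`(σ e).1`. -/
def permNeighbours (σ : Equiv.Perm (Fin v × Fin d)) (A : Finset (Fin v)) : Finset (Fin v) :=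
  (A ×ˢ univ).image fun e => (σ e).1

theorem mem_permNeighbours {σ : Equiv.Perm (Fin v × Fin d)} {A : Finset (Fin v)} {y : Fin v} :
    y ∈ permNeighbours σ A ↔ ∃ e, e.1 ∈ A ∧ (σ e).1 = y := by
  simp [permNeighbours]

theorem permNeighbours_mono (σ : Equiv.Perm (Fin v × Fin d)) {A B : Finset (Fin v)} (h : A ⊆ B) :
    permNeighbours σ A ⊆ permNeighbours σ B := by
  intro y hy
  obtain ⟨e, he, hy⟩ := mem_permNeighbours.1 hy
  exact mem_permNeighbours.2 ⟨e, h he, hy⟩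

/-- An edge from outside the neighbourhood of `A` cannot end in `A`. This is the source of the
duality between large sets on one side and small sets on the other. -/
theorem permNeighbours_inv_compl_subset (σ : Equiv.Perm (Fin v × Fin d)) (A : Finset (Fin v)) :
    permNeighbours σ⁻¹ (permNeighbours σ A)ᶜ ⊆ Aᶜ := by
  intro x hx
  obtain ⟨e, he, rfl⟩ := mem_permNeighbours.1 hx
  rw [mem_compl] at he ⊢
  exact fun h => he (mem_permNeighbours.2 ⟨σ⁻¹ e, h, by simp⟩)

/-- The bipartite multigraph on two copies of `Fin v` whose edge `e` joins `e.1` on the left to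
`(σ e).1` on the right. -/
def permGraph (σ : Equiv.Perm (Fin v × Fin d)) : Graph (Fin v ⊕ Fin v) (Fin v × Fin d) where
  vertexSet := Set.univ
  IsLink e x y := (x = .inl e.1 ∧ y = .inr (σ e).1) ∨ (x = .inr (σ e).1 ∧ y = .inl e.1)
  isLink_symm := fun e _ => ⟨fun x y h => by tauto⟩
  eq_or_eq_of_isLink_of_isLink := by
    rintro e x y z w (⟨rfl, rfl⟩ | ⟨rfl, rfl⟩) (⟨rfl, rfl⟩ | ⟨rfl, rfl⟩) <;> simp
  left_mem_of_isLink := fun _ _ _ _ => Set.mem_univ _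

theorem isBipartiteWith_permGraph (σ : Equiv.Perm (Fin v × Fin d)) :
    IsBipartiteWith (permGraph σ) (univ.map .inl) (univ.map .inr) where
  disjoint := by
    rw [disjoint_left]
    intro x hx hx'
    obtain ⟨a, -, rfl⟩ := mem_map.1 hx
    simp at hx'
  vertexSet_eq := by
    ext x
    cases x <;> simp [permGraph]
  edge_between := by
    rintro e x y (⟨rfl, rfl⟩ | ⟨rfl, rfl⟩) <;> simp

theorem card_fst_eq (i : Fin v) : #{e : Fin v × Fin d | e.1 = i} = d := by
  have : ({e : Fin v × Fin d | e.1 = i} : Finset _) = {i} ×ˢ univ := by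
    ext e
    simp only [mem_filter, mem_univ, true_and, mem_product, mem_singleton, and_true]
  rw [this]; simp

theorem isRegular_permGraph (σ : Equiv.Perm (Fin v × Fin d)) : IsRegular (permGraph σ) d := by
  intro x _
  have hloop : (permGraph σ).loopSet x = ∅ := by
    ext e
    simp only [Graph.mem_loopSet, Set.mem_empty_iff_false, iff_false]
    rintro (⟨rfl, h⟩ | ⟨rfl, h⟩) <;> simp at h
  rw [degree, hloop, Set.encard_empty, add_zero]
  cases x with
  | inl i =>
    have : (permGraph σ).incidenceSet (.inl i)
        = (({e : Fin v × Fin d | e.1 = i} : Finset _) : Set (Fin v × Fin d)) := by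
      ext e
      simp only [Graph.mem_incidenceSet, Graph.Inc, permGraph, coe_filter, mem_univ, true_and,
        Set.mem_ofPred_eq]
      constructor
      · rintro ⟨y, ⟨h, -⟩ | ⟨h, -⟩⟩
        · exact (Sum.inl_injective h).symm
        · simp at h
      · rintro rfl
        exact ⟨_, .inl ⟨rfl, rfl⟩⟩
    rw [this, Set.encard_coe_eq_coe_finsetCard, card_fst_eq]
  | inr i =>
    have : (permGraph σ).incidenceSet (.inr i)
        = ((({e : Fin v × Fin d | e.1 = i} : Finset _).map (σ⁻¹).toEmbedding : Finset _) :
          Set (Fin v × Fin d)) := by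
      ext e
      simp only [Graph.mem_incidenceSet, Graph.Inc, permGraph, mem_coe, mem_map, mem_filter,
        mem_univ, true_and]
      constructor
      · rintro ⟨y, ⟨h, -⟩ | ⟨h, -⟩⟩
        · simp at h
        · exact ⟨σ e, (Sum.inr_injective h).symm, by simp⟩
      · rintro ⟨e, rfl, rfl⟩
        exact ⟨_, .inr ⟨by simp, rfl⟩⟩
    rw [this, Set.encard_coe_eq_coe_finsetCard, card_map, card_fst_eq]

theorem neighbours_permGraph_inl (σ : Equiv.Perm (Fin v × Fin d)) (A : Finset (Fin v)) :
    (neighbours (permGraph σ) (A.map .inl)).ncard = #(permNeighbours σ A) := by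
  have : neighbours (permGraph σ) (A.map .inl)
      = ((permNeighbours σ A).map .inr : Finset (Fin v ⊕ Fin v)) := by
    ext y
    simp only [neighbours, mem_map, Set.mem_ofPred_eq, mem_coe, mem_permNeighbours]
    constructor
    · rintro ⟨_, ⟨a, ha, rfl⟩, e, ⟨h, rfl⟩ | ⟨h, rfl⟩⟩
      · exact ⟨_, ⟨e, by rwa [← Sum.inl_injective h], rfl⟩, rfl⟩
      · simp at h
    · rintro ⟨_, ⟨e, he, rfl⟩, rfl⟩
      exact ⟨_, ⟨e.1, he, rfl⟩, e, .inl ⟨rfl, rfl⟩⟩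
  rw [this, Set.ncard_coe_finset, card_map]

/-- Seen from the right, an edge is labelled by its image under `σ`, so the right side of `σ`
behaves like the left side of `σ⁻¹`. -/
theorem neighbours_permGraph_inr (σ : Equiv.Perm (Fin v × Fin d)) (A : Finset (Fin v)) :
    (neighbours (permGraph σ) (A.map .inr)).ncard = #(permNeighbours σ⁻¹ A) := by
  have : neighbours (permGraph σ) (A.map .inr)
      = ((permNeighbours σ⁻¹ A).map .inl : Finset (Fin v ⊕ Fin v)) := by
    ext y
    simp only [neighbours, mem_map, Set.mem_ofPred_eq, mem_coe, mem_permNeighbours]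
    constructor
    · rintro ⟨_, ⟨a, ha, rfl⟩, e, ⟨h, rfl⟩ | ⟨h, rfl⟩⟩
      · simp at h
      · exact ⟨_, ⟨σ e, by rwa [← Sum.inr_injective h], rfl⟩, by simp⟩
    · rintro ⟨_, ⟨e, he, rfl⟩, rfl⟩
      exact ⟨_, ⟨e.1, he, rfl⟩, σ⁻¹ e, .inr ⟨by simp, rfl⟩⟩
  rw [this, Set.ncard_coe_finset, card_map]

/-- The union bound over pairs `(A, S)` such that all neighbours of `A` lie in `S`. -/
theorem card_perm_exists_card_permNeighbours_le (m : ℕ) (w : ℕ → ℕ)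
    (hw : ∀ u ∈ Icc 1 m, w u ≤ v) :
    (#{σ : Equiv.Perm (Fin v × Fin d) | ∃ A, #A ∈ Icc 1 m ∧ #(permNeighbours σ A) ≤ w #A} : ℝ)
      ≤ (v * d).factorial * ∑ u ∈ Icc 1 m, (v.choose u : ℝ) * v.choose (w u) *
          ((d * w u).choose (d * u) / (d * v).choose (d * u)) := by
  have hsub : ({σ : Equiv.Perm (Fin v × Fin d) |
        ∃ A, #A ∈ Icc 1 m ∧ #(permNeighbours σ A) ≤ w #A} : Finset _)
      ⊆ (Icc 1 m).biUnion fun u => (powersetCard u univ ×ˢ powersetCard (w u) univ).biUnion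
          fun p => {σ : Equiv.Perm (Fin v × Fin d) | ∀ e ∈ p.1 ×ˢ univ, σ e ∈ p.2 ×ˢ univ} := by
    intro σ hσ
    obtain ⟨A, hA, hN⟩ := (mem_filter.1 hσ).2
    -- Enlarging the neighbourhood to exactly `w #A` elements leaves one target size per `u` in the
    -- union bound.
    obtain ⟨S, hS, hS'⟩ := exists_superset_card_eq hN (by simpa using hw _ hA)
    simp only [mem_biUnion, mem_product, mem_powersetCard, subset_univ, true_and, mem_filter,
      mem_univ, and_true]
    exact ⟨#A, hA, (A, S), ⟨rfl, hS'⟩, fun e he => hS (mem_permNeighbours.2 ⟨e, he, rfl⟩)⟩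
  calc _ ≤ ((∑ u ∈ Icc 1 m, ∑ p ∈ powersetCard u (univ : Finset (Fin v)) ×ˢ
        powersetCard (w u) (univ : Finset (Fin v)),
        #{σ : Equiv.Perm (Fin v × Fin d) | ∀ e ∈ p.1 ×ˢ univ, σ e ∈ p.2 ×ˢ univ} : ℕ) : ℝ) := by
        exact_mod_cast (card_le_card hsub).trans
          (card_biUnion_le.trans (sum_le_sum fun u _ => card_biUnion_le))
    _ = _ := by
        push_cast
        rw [mul_sum]
        refine sum_congr rfl fun u hu => ?_
        -- `m` may exceed `v`; for `v < u` both sides vanish.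
        have huv : 0 < (d * v).choose (d * u) ∨ v < u := by
          by_cases h : u ≤ v
          · exact .inl (Nat.choose_pos (Nat.mul_le_mul_left _ h))
          · exact .inr (not_le.1 h)
        rcases huv with hpos | h
        · have hterm : ∀ p ∈ powersetCard u (univ : Finset (Fin v)) ×ˢ
              powersetCard (w u) (univ : Finset (Fin v)),
              (#{σ : Equiv.Perm (Fin v × Fin d) | ∀ e ∈ p.1 ×ˢ univ, σ e ∈ p.2 ×ˢ univ} : ℝ)
                = (v * d).factorial * ((d * w u).choose (d * u) / (d * v).choose (d * u)) := by
            intro p hp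
            obtain ⟨h1, h2⟩ := mem_product.1 hp
            have h1 := (mem_powersetCard.1 h1).2
            have h2 := (mem_powersetCard.1 h2).2
            have := card_perm_mapsTo_mul_choose (p.1 ×ˢ (univ : Finset (Fin d)))
              (p.2 ×ˢ (univ : Finset (Fin d)))
            rw [card_product, card_product, h1, h2, card_univ, Fintype.card_prod,
              Fintype.card_fin, Fintype.card_fin, mul_comm v d, mul_comm u d,
              mul_comm (w u) d] at this
            rw [mul_div_assoc', eq_div_iff (by positivity), mul_comm v d]
            exact_mod_cast this
          rw [sum_congr rfl hterm, sum_const, card_product, card_powersetCard, card_powersetCard,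
            card_univ, Fintype.card_fin, nsmul_eq_mul]
          push_cast
          ring
        · have : powersetCard u (univ : Finset (Fin v)) = ∅ :=
            powersetCard_eq_empty.2 (by simpa using h)
          simp [this, Nat.choose_eq_zero_of_lt h]

/-- Fewer than half of the permutations are bad, and inversion is a bijection, so some `σ` is such
that neither it nor its inverse is bad. -/
theorem exists_perm_lt_card_permNeighbours (m : ℕ) (w : ℕ → ℕ) (hw : ∀ u ∈ Icc 1 m, w u ≤ v)
    (h : ∑ u ∈ Icc 1 m, (v.choose u : ℝ) * v.choose (w u) *
          ((d * w u).choose (d * u) / (d * v).choose (d * u)) < 1 / 2) :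
    ∃ σ : Equiv.Perm (Fin v × Fin d), ∀ A, #A ∈ Icc 1 m →
      w #A < #(permNeighbours σ A) ∧ w #A < #(permNeighbours σ⁻¹ A) := by
  set B : Finset (Equiv.Perm (Fin v × Fin d)) :=
    {σ | ∃ A, #A ∈ Icc 1 m ∧ #(permNeighbours σ A) ≤ w #A} with hB
  have hcard : (#B : ℝ) < (v * d).factorial * (1 / 2) :=
    (card_perm_exists_card_permNeighbours_le m w hw).trans_lt
      (mul_lt_mul_of_pos_left h (by positivity))
  have hlt : #(B ∪ B.map (Equiv.inv _).toEmbedding)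
      < #(univ : Finset (Equiv.Perm (Fin v × Fin d))) := by
    refine (card_union_le _ _).trans_lt ?_
    rw [card_map, card_univ, Fintype.card_perm, Fintype.card_prod, Fintype.card_fin,
      Fintype.card_fin]
    have : (#B + #B : ℝ) < (v * d).factorial := by linarith
    exact_mod_cast this
  obtain ⟨σ, -, hσ⟩ := exists_mem_notMem_of_card_lt_card hlt
  rw [mem_union, not_or] at hσ
  refine ⟨σ, fun A hA => ⟨?_, ?_⟩⟩
  · by_contra hc
    exact hσ.1 (mem_filter.2 ⟨mem_univ _, A, hA, not_lt.1 hc⟩)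
  · by_contra hc
    refine hσ.2 (mem_map.2 ⟨σ⁻¹, mem_filter.2 ⟨mem_univ _, A, hA, not_lt.1 hc⟩, ?_⟩)
    simp

end PermGraph

end BipartiteExpander

namespace BipartiteExpander

open Finset Real

/-! ### Binomial coefficients and entropy -/

theorem choose_mul_pow_mul_pow_le_one (n k : ℕ) {p : ℝ} (h0 : 0 ≤ p) (h1 : p ≤ 1) :
    (n.choose k : ℝ) * (p ^ k * (1 - p) ^ (n - k)) ≤ 1 := by
  rcases lt_or_ge n k with hk | hk
  · simp [Nat.choose_eq_zero_of_lt hk]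
  have hsum : ∑ j ∈ range (n + 1), p ^ j * (1 - p) ^ (n - j) * (n.choose j : ℝ) = 1 := by
    rw [← add_pow]; simp
  have h1' : 0 ≤ 1 - p := by linarith
  rw [mul_comm]
  refine le_of_le_of_eq ?_ hsum
  exact single_le_sum (f := fun j => p ^ j * (1 - p) ^ (n - j) * (n.choose j : ℝ))
    (fun j _ => by positivity) (mem_range.2 (Nat.lt_succ_of_le hk))

/-- A single term of `(p + (1 - p)) ^ n` is at most one. Keeping `p` free allows the densities `y`
and `x / y` to be used without rounding. -/
theorem choose_le_exp (n k : ℕ) {p : ℝ} (h0 : 0 < p) (h1 : p < 1) :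
    (n.choose k : ℝ) ≤ exp (-(k * log p) - (n - k) * log (1 - p)) := by
  rcases lt_or_ge n k with hk | hk
  · rw [Nat.choose_eq_zero_of_lt hk]
    simpa using (exp_pos _).le
  have h1' : 0 < 1 - p := by linarith
  have hpow : p ^ k * (1 - p) ^ (n - k) = exp (k * log p + (n - k) * log (1 - p)) := by
    rw [exp_add, ← Nat.cast_sub hk, exp_nat_mul, exp_nat_mul, exp_log h0, exp_log h1']
  have := choose_mul_pow_mul_pow_le_one n k h0.le h1.le
  rw [hpow] at this
  calc (n.choose k : ℝ) = n.choose k * exp (k * log p + (n - k) * log (1 - p)) *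
        exp (-(k * log p) - (n - k) * log (1 - p)) := by
        rw [mul_assoc, ← exp_add]; ring_nf; simp
    _ ≤ 1 * exp (-(k * log p) - (n - k) * log (1 - p)) := by gcongr
    _ = _ := one_mul _

/-- The mode of the binomial distribution with parameters `n` and `k / n` is `k`. -/
theorem choose_mul_pow_mul_pow_le_mode {n k : ℕ} (hk : k ≤ n) {j : ℕ} (hj : j ≤ n) :
    (n.choose j : ℝ) * ((k : ℝ) ^ j * ((n : ℝ) - k) ^ (n - j))
      ≤ n.choose k * ((k : ℝ) ^ k * ((n : ℝ) - k) ^ (n - k)) := by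
  obtain ⟨l, rfl⟩ := Nat.exists_eq_add_of_le hk
  set t : ℕ → ℝ := fun j => ((k + l).choose j : ℝ) * ((k : ℝ) ^ j * (l : ℝ) ^ (k + l - j)) with ht
  have hcast : ((k + l : ℕ) : ℝ) - k = l := by push_cast; ring
  -- The ratio of consecutive terms crosses one at `i = k`, so `t` rises up to `k` and falls
  -- afterwards.
  have hratio : ∀ i, i < k + l → t (i + 1) * ((i + 1) * l) = t i * ((k + l - i) * k) := by
    intro i hi
    have hc : ((k + l).choose (i + 1) : ℝ) * (i + 1) = (k + l).choose i * (k + l - i) := by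
      have := Nat.choose_succ_right_eq (k + l) i
      have h2 : (((k + l).choose (i + 1) * (i + 1) : ℕ) : ℝ)
          = (((k + l).choose i * (k + l - i) : ℕ) : ℝ) := by rw [this]
      rw [Nat.cast_mul, Nat.cast_mul, Nat.cast_sub hi.le] at h2
      push_cast at h2
      exact h2
    have he : k + l - i = (k + l - (i + 1)) + 1 := by omega
    simp only [ht]
    rw [he, pow_succ, pow_succ]
    linear_combination (k : ℝ) ^ i * k * (l : ℝ) ^ (k + l - (i + 1)) * l * hc
  have ht0 : ∀ i, 0 ≤ t i := fun i => by simp only [ht]; positivity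
  -- For `l = 0` or `k = 0` the distribution is a point mass and the ratio argument would divide by
  -- zero.
  rcases Nat.eq_zero_or_pos l with rfl | hl
  · rw [hcast]
    rcases hj.eq_or_lt with rfl | hlt
    · simp
    · have : k + 0 - j ≠ 0 := by omega
      simp only [Nat.cast_zero, zero_pow this, mul_zero]
      positivity
  rcases Nat.eq_zero_or_pos k with rfl | hk0
  · rw [hcast]
    rcases Nat.eq_zero_or_pos j with rfl | hj0
    · simp
    · simp only [Nat.cast_zero, zero_pow hj0.ne', zero_mul, mul_zero]
      positivity
  have hl' : (0 : ℝ) < l := by exact_mod_cast hl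
  have hk' : (0 : ℝ) < k := by exact_mod_cast hk0
  have hup : ∀ i, i < k → t i ≤ t (i + 1) := by
    intro i hi
    have hi' : (i : ℝ) + 1 ≤ k := by exact_mod_cast hi
    have h := hratio i (by omega)
    have hle : (i + 1 : ℝ) * l ≤ (k + l - i) * k := by nlinarith
    have hp : (0 : ℝ) < (i + 1) * l := by positivity
    refine le_of_mul_le_mul_right ?_ hp
    rw [h]
    exact mul_le_mul_of_nonneg_left hle (ht0 i)
  have hdown : ∀ i, k ≤ i → i < k + l → t (i + 1) ≤ t i := by
    intro i hi hi2
    have hi' : (k : ℝ) ≤ i := by exact_mod_cast hi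
    have h := hratio i hi2
    have hle : (k + l - i : ℝ) * k ≤ (i + 1) * l := by nlinarith
    have hp : (0 : ℝ) < (i + 1) * l := by positivity
    refine le_of_mul_le_mul_right ?_ hp
    rw [h]
    exact mul_le_mul_of_nonneg_left hle (ht0 i)
  have hgoal : t j ≤ t k := by
    rcases le_total j k with hjk | hjk
    · exact Nat.decreasingInduction' (P := fun i => t i ≤ t k)
        (fun i hi _ ih => (hup i hi).trans ih) hjk le_rfl
    · have : ∀ i, k ≤ i → i ≤ k + l → t i ≤ t k := by
        intro i hi
        induction i, hi using Nat.le_induction with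
        | base => intro _; exact le_rfl
        | succ i hi ih => intro h; exact (hdown i hi (by omega)).trans (ih (by omega))
      exact this j hjk hj
  rw [hcast]
  exact hgoal

/-- The `n + 1` binomial probabilities sum to one, so the one at the mode is at least `1 / (n + 1)`.
This polynomial loss is harmless and replaces Stirling's formula. -/
theorem exp_le_mul_choose {n k : ℕ} (hk0 : 0 < k) (hk : k < n) :
    exp (-(k * log (k / n)) - (n - k) * log (1 - k / n)) ≤ (n + 1) * n.choose k := by
  have hn : (0 : ℝ) < n := by exact_mod_cast hk0.trans hk
  have hk0' : (0 : ℝ) < k := by exact_mod_cast hk0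
  have hkn : (k : ℝ) < n := by exact_mod_cast hk
  have hp0 : (0 : ℝ) < k / n := by positivity
  have hq : (1 : ℝ) - k / n = (n - k) / n := by field_simp
  have hp1 : (0 : ℝ) < 1 - k / n := by rw [hq]; exact div_pos (by linarith) hn
  have hscale : ∀ j ≤ n, ((k : ℝ) / n) ^ j * (1 - k / n) ^ (n - j)
      = ((k : ℝ) ^ j * (n - k) ^ (n - j)) / (n : ℝ) ^ n := by
    intro j hj
    rw [hq, div_pow, div_pow, div_mul_div_comm, ← pow_add, Nat.add_sub_cancel' hj]
  have hsum : ∑ j ∈ range (n + 1),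
      ((k : ℝ) / n) ^ j * (1 - k / n) ^ (n - j) * (n.choose j : ℝ) = 1 := by
    rw [← add_pow]; simp
  have hle : (1 : ℝ) ≤ (n + 1) * (n.choose k * (((k : ℝ) / n) ^ k * (1 - k / n) ^ (n - k))) := by
    calc _ = _ := hsum.symm
      _ ≤ ∑ j ∈ range (n + 1),
          (n.choose k * (((k : ℝ) / n) ^ k * (1 - k / n) ^ (n - k))) := by
          refine sum_le_sum fun j hj => ?_
          have hj : j ≤ n := by simpa [Nat.lt_succ_iff] using hj
          rw [mul_comm, hscale j hj, hscale k hk.le, mul_div_assoc', mul_div_assoc']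
          exact div_le_div_of_nonneg_right (choose_mul_pow_mul_pow_le_mode hk.le hj)
            (by positivity)
      _ = _ := by rw [sum_const, card_range, nsmul_eq_mul]; push_cast; ring
  have hpow : ((k : ℝ) / n) ^ k * (1 - k / n) ^ (n - k)
      = exp (k * log (k / n) + (n - k) * log (1 - k / n)) := by
    rw [exp_add, ← Nat.cast_sub hk.le, exp_nat_mul, exp_nat_mul, exp_log hp0, exp_log hp1]
  rw [hpow] at hle
  calc _ = 1 * exp (-(k * log (k / n)) - (n - k) * log (1 - k / n)) := (one_mul _).symm
    _ ≤ (n + 1) * (n.choose k * exp (k * log (k / n) + (n - k) * log (1 - k / n))) *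
        exp (-(k * log (k / n)) - (n - k) * log (1 - k / n)) := by gcongr
    _ = _ := by
        rw [mul_assoc, mul_assoc, ← exp_add]; ring_nf; simp

/-- The exponential growth rate of the expected number of pairs of sets of sizes `x v` and `y v`
such that all neighbours of the first set lie in the second, in a random `d`-regular bipartite
multigraph. -/
noncomputable def rate (d x y : ℝ) : ℝ :=
  -(x * log x) + (d - 1) * ((1 - x) * log (1 - x)) + (d - 1) * (y * log y)
    - (1 - y) * log (1 - y) - d * ((y - x) * log (y - x))

theorem expected_pairs_le {d v u w : ℕ} (hd : 0 < d) (hu : 0 < u) {y : ℝ} (hxy : (u : ℝ) / v < y)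
    (hy : y ≤ 4 / 5) (hw : w ≤ y * v) (hw' : y * v ≤ w + 1) :
    (v.choose u : ℝ) * v.choose w * ((d * w).choose (d * u) / (d * v).choose (d * u))
      ≤ 4 * (d * v + 1) * exp (v * rate d (u / v) y) := by
  have hu' : (0 : ℝ) < u := by exact_mod_cast hu
  rcases Nat.eq_zero_or_pos v with rfl | hv
  · simp [Nat.choose_eq_zero_of_lt hu]
  have hv' : (0 : ℝ) < v := by exact_mod_cast hv
  have hd' : (0 : ℝ) < d := by exact_mod_cast hd
  set x : ℝ := u / v with hx
  have hx0 : 0 < x := by positivity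
  have hxv : (u : ℝ) = x * v := by rw [hx]; field_simp
  have huv : u < v := by
    have : (u : ℝ) < v := by rw [hxv]; nlinarith
    exact_mod_cast this
  have hy0 : 0 < y := hx0.trans hxy
  have hq0 : 0 < x / y := by positivity
  have hq1 : x / y < 1 := (div_lt_one hy0).2 hxy
  have hlq : log (x / y) = log x - log y := log_div hx0.ne' hy0.ne'
  have hlq' : log (1 - x / y) = log (y - x) - log y := by
    rw [← log_div (by linarith) hy0.ne']; congr 1; field_simp
  have hlq0 : log (1 - x / y) ≤ 0 := log_nonpos (by linarith) (by linarith)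
  have b1 := choose_le_exp v u hx0 (show x < 1 by linarith)
  -- Replacing `w / v` by `y` costs the factor `(y / (1 - y)) ^ (y * v - w)`, at most `4` because `y
  -- ≤ 4 / 5` and `0 ≤ y * v - w ≤ 1`.
  have b2 : (v.choose w : ℝ) ≤ 4 * exp (v * (-(y * log y) - (1 - y) * log (1 - y))) := by
    refine (choose_le_exp v w hy0 (by linarith)).trans ?_
    rw [show (4 : ℝ) = exp (log 4) by rw [exp_log]; norm_num, ← exp_add, exp_le_exp]
    have hle : log y - log (1 - y) ≤ log 4 := by
      rw [← log_div hy0.ne' (by linarith)]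
      refine log_le_log (div_pos hy0 (by linarith)) ?_
      rw [div_le_iff₀ (by linarith)]; linarith
    have h4 : (0 : ℝ) ≤ log 4 := log_nonneg (by norm_num)
    have : (y * v - w) * (log y - log (1 - y)) ≤ log 4 := by nlinarith
    linarith
  -- Here the rounding costs nothing: `log (1 - x / y) ≤ 0` makes the bound increasing in `w`.
  have b3 : ((d * w).choose (d * u) : ℝ)
      ≤ exp (v * (-(d * x * (log x - log y)) - d * (y - x) * (log (y - x) - log y))) := by
    refine (choose_le_exp (d * w) (d * u) hq0 hq1).trans ?_
    rw [exp_le_exp]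
    push_cast
    rw [hlq, hlq', hxv]
    rw [hlq'] at hlq0
    have : (d * w : ℝ) ≤ d * (y * v) := by gcongr
    nlinarith
  have b4 := exp_le_mul_choose (n := d * v) (k := d * u) (by positivity)
    (Nat.mul_lt_mul_of_pos_left huv hd)
  have hdx : ((d * u : ℕ) : ℝ) / ((d * v : ℕ) : ℝ) = x := by
    push_cast; rw [hx]; field_simp
  rw [hdx] at b4
  push_cast at b4
  have hcpos : (0 : ℝ) < (d * v).choose (d * u) := by
    exact_mod_cast Nat.choose_pos (Nat.mul_le_mul_left d huv.le)
  rw [mul_div_assoc', div_le_iff₀ hcpos]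
  calc (v.choose u : ℝ) * v.choose w * (d * w).choose (d * u)
      ≤ exp (-(u * log x) - (v - u) * log (1 - x)) *
        (4 * exp (v * (-(y * log y) - (1 - y) * log (1 - y)))) *
        exp (v * (-(d * x * (log x - log y)) - d * (y - x) * (log (y - x) - log y))) := by
        gcongr
    _ = 4 * exp (v * rate d x y) *
        exp (-(d * u * log x) - (d * v - d * u) * log (1 - x)) := by
        have h := congrArg exp (show (-(u * log x) - (v - u) * log (1 - x)) +
          (v * (-(y * log y) - (1 - y) * log (1 - y))) +
          (v * (-(d * x * (log x - log y)) - d * (y - x) * (log (y - x) - log y)))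
          = v * rate d x y + (-(d * u * log x) - (d * v - d * u) * log (1 - x)) by
            rw [rate, hxv]; ring)
        rw [exp_add, exp_add, exp_add] at h
        linear_combination 4 * h
    _ ≤ 4 * exp (v * rate d x y) * ((d * v + 1) * (d * v).choose (d * u)) := by gcongr
    _ = _ := by ring

end BipartiteExpander

namespace BipartiteExpander

open Finset Real Filter Topology

/-! ### Existence from a bound on the rate -/

/-- The summand `exp K / v ^ 2` accounts for singletons, the factor `v` for the number of larger
sizes. -/
theorem tendsto_union_bound (d K δ : ℝ) (hδ : 0 < δ) :
    Tendsto (fun v : ℝ => 4 * (d * v + 1) * (exp K / v ^ 2 +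
      v * (16 * exp (2 * K) / v ^ 4 + exp (-(δ * v))))) atTop (𝓝 0) := by
  have hinv : Tendsto (fun v : ℝ => v⁻¹) atTop (𝓝 0) := tendsto_inv_atTop_zero
  have hexp : Tendsto (fun v : ℝ => (δ * v) ^ 2 * exp (-(δ * v))) atTop (𝓝 0) :=
    (tendsto_pow_mul_exp_neg_atTop_nhds_zero 2).comp (tendsto_id.const_mul_atTop hδ)
  have hlim : Tendsto (fun v : ℝ => 4 * (d + v⁻¹) * (exp K * v⁻¹ + 16 * exp (2 * K) * v⁻¹ ^ 2 +
      (δ ^ 2)⁻¹ * ((δ * v) ^ 2 * exp (-(δ * v))))) atTop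
      (𝓝 (4 * (d + 0) * (exp K * 0 + 16 * exp (2 * K) * 0 ^ 2 + (δ ^ 2)⁻¹ * 0))) :=
    ((tendsto_const_nhds.add hinv).const_mul 4).mul
      (((hinv.const_mul _).add ((hinv.pow 2).const_mul _)).add (hexp.const_mul _))
  have h0 : 4 * (d + 0) * (exp K * 0 + 16 * exp (2 * K) * 0 ^ 2 + (δ ^ 2)⁻¹ * 0) = 0 := by ring
  rw [h0] at hlim
  refine hlim.congr' ?_
  filter_upwards [eventually_gt_atTop 0] with v hv
  field_simp
  ring

/-- If the rate along the graph of `F` is negative, and small near zero, then for large `v` some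
`d`-regular bipartite multigraph expands all sets of size at most `x₁ v` according to `F`. -/
theorem exists_perm_of_rate {d : ℕ} (hd : 0 < d) {F : ℝ → ℝ} {x₁ ε δ K : ℝ} (hx₁ : x₁ ≤ 1)
    (hε : 0 < ε) (hδ : 0 < δ) (hF : ∀ x, 0 < x → x ≤ x₁ → x < F x ∧ F x ≤ 4 / 5)
    (hmax : ∀ a x, 0 < a → a ≤ ε → a ≤ x → x ≤ x₁ →
      rate d x (F x) ≤ max (rate d a (F a)) (-δ))
    (hsmall : ∀ x, 0 < x → x ≤ ε → rate d x (F x) ≤ 2 * (x * log x) + K * x) :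
    ∃ v₀ : ℕ, ∀ v : ℕ, v₀ ≤ v → ∃ σ : Equiv.Perm (Fin v × Fin d), ∀ A, 0 < #A → #A ≤ x₁ * v →
      F (#A / v) * v ≤ #(permNeighbours σ A) ∧ F (#A / v) * v ≤ #(permNeighbours σ⁻¹ A) := by
  have htend := (tendsto_union_bound d K δ hδ).comp tendsto_natCast_atTop_atTop
  have hev := (htend.eventually (gt_mem_nhds (show (0 : ℝ) < 1 / 2 by norm_num))).and
    ((tendsto_natCast_atTop_atTop (R := ℝ)).eventually (eventually_ge_atTop (max 1 (2 / ε))))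
  obtain ⟨v₀, hv₀⟩ := eventually_atTop.1 hev
  refine ⟨v₀, fun v hv => ?_⟩
  obtain ⟨hbound, hlarge⟩ := hv₀ v hv
  have hv1 : (1 : ℝ) ≤ v := (le_max_left _ _).trans hlarge
  have hvpos : (0 : ℝ) < v := by linarith
  have hvε : 2 / v ≤ ε := by
    rw [div_le_iff₀ hvpos, ← div_le_iff₀' hε]
    exact (le_max_right _ _).trans hlarge
  have hnear : ∀ k : ℝ, 0 < k → k ≤ 2 →
      exp (v * rate d (k / v) (F (k / v))) ≤ exp (2 * k * log (k / v) + K * k) := by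
    intro k hk hk2
    have hle : k / v ≤ ε := le_trans (by gcongr) hvε
    rw [exp_le_exp]
    calc v * rate d (k / v) (F (k / v)) ≤ v * (2 * (k / v * log (k / v)) + K * (k / v)) := by
          gcongr
          exact hsmall _ (by positivity) hle
      _ = _ := by field_simp
  have hone : exp (v * rate d (1 / v) (F (1 / v))) ≤ exp K / (v : ℝ) ^ 2 := by
    refine (hnear 1 one_pos (by norm_num)).trans_eq ?_
    rw [show 2 * 1 * log (1 / (v : ℝ)) + K * 1 = K + ((2 : ℕ) : ℝ) * log (1 / v) by
      push_cast; ring, exp_add, exp_nat_mul, exp_log (by positivity)]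
    field_simp
  have htwo : exp (v * rate d (2 / v) (F (2 / v))) ≤ 16 * exp (2 * K) / (v : ℝ) ^ 4 := by
    refine (hnear 2 two_pos le_rfl).trans_eq ?_
    rw [show 2 * 2 * log (2 / (v : ℝ)) + K * 2 = 2 * K + ((4 : ℕ) : ℝ) * log (2 / v) by
      push_cast; ring, exp_add, exp_nat_mul, exp_log (by positivity)]
    field_simp
    norm_num
  set m := ⌊x₁ * v⌋₊ with hm
  -- The largest integer strictly below `F (u / v) * v`: having more than `w u` neighbours means
  -- having at least `F (u / v) * v`.
  set w : ℕ → ℕ := fun u => ⌈F (u / v) * v⌉₊ - 1 with hw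
  have hmem : ∀ u ∈ Icc 1 m, 0 < u ∧ 0 < (u : ℝ) / v ∧ (u : ℝ) / v ≤ x₁ := by
    intro u hu
    obtain ⟨h1, h2⟩ := mem_Icc.1 hu
    have hu0 : (0 : ℝ) < u := by exact_mod_cast h1
    exact ⟨h1, by positivity, (div_le_iff₀ hvpos).2 ((Nat.le_floor_iff' (by omega)).1 h2)⟩
  have hwbound : ∀ u ∈ Icc 1 m, (w u : ℝ) ≤ F (u / v) * v ∧ F (u / v) * v ≤ w u + 1 := by
    intro u hu
    obtain ⟨-, h2, h3⟩ := hmem u hu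
    have hpos : 0 < F (u / v) * v := mul_pos (h2.trans (hF _ h2 h3).1) hvpos
    have hc : 1 ≤ ⌈F (u / v) * v⌉₊ := Nat.one_le_ceil_iff.2 hpos
    have hcast : (w u : ℝ) = (⌈F (u / v) * v⌉₊ : ℝ) - 1 := by simp [hw, Nat.cast_sub hc]
    rw [hcast]
    exact ⟨by linarith [Nat.ceil_lt_add_one hpos.le], by linarith [Nat.le_ceil (F (u / v) * v)]⟩
  have hwv : ∀ u ∈ Icc 1 m, w u ≤ v := by
    intro u hu
    obtain ⟨-, h2, h3⟩ := hmem u hu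
    have := (hwbound u hu).1
    have : (w u : ℝ) ≤ v := by nlinarith [(hF _ h2 h3).2]
    exact_mod_cast this
  have hsum : ∑ u ∈ Icc 1 m, (v.choose u : ℝ) * v.choose (w u) *
      ((d * w u).choose (d * u) / (d * v).choose (d * u)) < 1 / 2 := by
    set Y : ℝ := 16 * exp (2 * K) / (v : ℝ) ^ 4 + exp (-(δ * v)) with hY
    have hY0 : 0 ≤ Y := by positivity
    -- Singletons are kept apart: the bound `exp K / v ^ 2` for all of up to `v` sizes would not
    -- beat the prefactor of order `v`. From `u = 2` on, comparison with `2 / v` gives order `v ^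
    -- (-4)`.
    have hterm : ∀ u ∈ Icc 1 m, (v.choose u : ℝ) * v.choose (w u) *
        ((d * w u).choose (d * u) / (d * v).choose (d * u))
        ≤ 4 * (d * v + 1) * ((if u = 1 then exp K / (v : ℝ) ^ 2 else 0) + Y) := by
      intro u hu
      obtain ⟨h1, h2, h3⟩ := hmem u hu
      refine (expected_pairs_le hd h1 (hF _ h2 h3).1 (hF _ h2 h3).2 (hwbound u hu).1
        (hwbound u hu).2).trans ?_
      gcongr
      split_ifs with hu1
      · rw [hu1, Nat.cast_one]
        linarith
      · have hu2 : (2 : ℝ) ≤ u := by exact_mod_cast (show 2 ≤ u by omega)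
        have h := hmax (2 / v) (u / v) (by positivity) hvε (by gcongr) h3
        rw [zero_add]
        rcases le_max_iff.1 h with h | h
        · have : exp (v * rate d (u / v) (F (u / v))) ≤ exp (v * rate d (2 / v) (F (2 / v))) := by
            gcongr
          linarith [exp_pos (-(δ * v))]
        · have : exp (v * rate d (u / v) (F (u / v))) ≤ exp (-(δ * v)) := by
            rw [exp_le_exp]
            nlinarith
          have h16 : 0 ≤ 16 * exp (2 * K) / (v : ℝ) ^ 4 := by positivity
          linarith
    have hmv : (m : ℝ) ≤ v := by
      rcases le_total 0 x₁ with h | h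
      · exact (Nat.floor_le (by positivity)).trans (by nlinarith)
      · rw [hm, Nat.floor_of_nonpos (by nlinarith)]
        simp
    refine (sum_le_sum hterm).trans_lt (lt_of_le_of_lt ?_ hbound)
    rw [← mul_sum, sum_add_distrib, sum_const, Nat.card_Icc, nsmul_eq_mul, Nat.add_sub_cancel]
    simp only [Function.comp]
    gcongr
    rw [sum_ite_eq']
    split_ifs
    · exact le_rfl
    · positivity
  obtain ⟨σ, hσ⟩ := exists_perm_lt_card_permNeighbours (d := d) m w hwv hsum
  refine ⟨σ, fun A hA hAx => ?_⟩
  have hAm : #A ∈ Icc 1 m := mem_Icc.2 ⟨hA, Nat.le_floor hAx⟩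
  obtain ⟨h1, h2⟩ := hσ A hAm
  have h := (hwbound _ hAm).2
  constructor
  · exact h.trans (by exact_mod_cast h1)
  · exact h.trans (by exact_mod_cast h2)

/-! ### The rate along a line -/

theorem hasDerivAt_affine_mul_log (m k x : ℝ) (h : m * x + k ≠ 0) :
    HasDerivAt (fun x => (m * x + k) * log (m * x + k)) (m * (log (m * x + k) + 1)) x := by
  have h1 : HasDerivAt (fun x => m * x + k) m x := by
    simpa using ((hasDerivAt_id x).const_mul m).add_const k
  have h2 := (hasDerivAt_mul_log h).comp x h1
  rw [mul_comm] at h2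
  exact h2

theorem hasDerivAt_log_affine (m k x : ℝ) (h : m * x + k ≠ 0) :
    HasDerivAt (fun x => log (m * x + k)) (m / (m * x + k)) x := by
  have h1 : HasDerivAt (fun x => m * x + k) m x := by
    simpa using ((hasDerivAt_id x).const_mul m).add_const k
  exact h1.log h

theorem convexOn_rate {d s c a b : ℝ} (ha : 0 < a)
    (hy : ∀ x, a ≤ x → x ≤ b → x < s * x + c ∧ s * x + c < 1)
    (h : ∀ x, a ≤ x → x ≤ b → 1 / x + s ^ 2 / (1 - (s * x + c)) +
      d * (s - 1) ^ 2 / ((s * x + c) - x) ≤ (d - 1) / (1 - x) + (d - 1) * s ^ 2 / (s * x + c)) :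
    ConvexOn ℝ (Set.Icc a b) fun x => rate d x (s * x + c) := by
  have hd1 : ∀ x, a ≤ x → x ≤ b → HasDerivAt (fun x => rate d x (s * x + c))
      (-(1 * (log (1 * x + 0) + 1)) + (d - 1) * (-1 * (log (-1 * x + 1) + 1))
        + (d - 1) * (s * (log (s * x + c) + 1)) - -s * (log (-s * x + (1 - c)) + 1)
        - d * ((s - 1) * (log ((s - 1) * x + c) + 1))) x := by
    intro x h1 h2
    obtain ⟨h3, h4⟩ := hy x h1 h2
    have := ((((hasDerivAt_affine_mul_log 1 0 x (by linarith)).neg).add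
      ((hasDerivAt_affine_mul_log (-1) 1 x (by linarith)).const_mul (d - 1))).add
      ((hasDerivAt_affine_mul_log s c x (by linarith)).const_mul (d - 1))).sub
      (hasDerivAt_affine_mul_log (-s) (1 - c) x (by linarith)) |>.sub
      ((hasDerivAt_affine_mul_log (s - 1) c x (by linarith)).const_mul d)
    refine this.congr_of_eventuallyEq (Eventually.of_forall fun t => ?_)
    simp only [rate, Pi.add_apply, Pi.sub_apply, Pi.neg_apply]
    ring_nf
  have hd2 : ∀ x, a ≤ x → x ≤ b → HasDerivAt (fun x =>
      -(1 * (log (1 * x + 0) + 1)) + (d - 1) * (-1 * (log (-1 * x + 1) + 1))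
        + (d - 1) * (s * (log (s * x + c) + 1)) - -s * (log (-s * x + (1 - c)) + 1)
        - d * ((s - 1) * (log ((s - 1) * x + c) + 1)))
      (-(1 * (1 / (1 * x + 0))) + (d - 1) * (-1 * (-1 / (-1 * x + 1)))
        + (d - 1) * (s * (s / (s * x + c))) - -s * (-s / (-s * x + (1 - c)))
        - d * ((s - 1) * ((s - 1) / ((s - 1) * x + c)))) x := by
    intro x h1 h2
    obtain ⟨h3, h4⟩ := hy x h1 h2
    exact (((((hasDerivAt_log_affine 1 0 x (by linarith)).add_const 1).const_mul 1).neg.add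
      ((((hasDerivAt_log_affine (-1) 1 x (by linarith)).add_const 1).const_mul (-1)).const_mul
        (d - 1))).add
      ((((hasDerivAt_log_affine s c x (by linarith)).add_const 1).const_mul s).const_mul
        (d - 1))).sub
      (((hasDerivAt_log_affine (-s) (1 - c) x (by linarith)).add_const 1).const_mul (-s)) |>.sub
      ((((hasDerivAt_log_affine (s - 1) c x (by linarith)).add_const 1).const_mul
        (s - 1)).const_mul d)
  refine convexOn_of_hasDerivWithinAt2_nonneg (convex_Icc a b)
    (fun x hx => (hd1 x hx.1 hx.2).continuousAt.continuousWithinAt)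
    (fun x hx => (hd1 x (interior_subset hx).1 (interior_subset hx).2).hasDerivWithinAt)
    (fun x hx => (hd2 x (interior_subset hx).1 (interior_subset hx).2).hasDerivWithinAt) ?_
  intro x hx
  have hx := interior_subset hx
  have hx' := h x hx.1 hx.2
  have e1 : (1 : ℝ) * x + 0 = x := by ring
  have e2 : -1 * x + 1 = 1 - x := by ring
  have e3 : -s * x + (1 - c) = 1 - (s * x + c) := by ring
  have e4 : (s - 1) * x + c = s * x + c - x := by ring
  rw [e1, e2, e3, e4]
  have e5 : -(1 * (1 / x)) + (d - 1) * (-1 * (-1 / (1 - x))) + (d - 1) * (s * (s / (s * x + c)))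
      - -s * (-s / (1 - (s * x + c))) - d * ((s - 1) * ((s - 1) / (s * x + c - x)))
      = (d - 1) / (1 - x) + (d - 1) * s ^ 2 / (s * x + c)
        - (1 / x + s ^ 2 / (1 - (s * x + c)) + d * (s - 1) ^ 2 / ((s * x + c) - x)) := by ring
  rw [e5]
  linarith

theorem rate_le_max {d s c a b x : ℝ} (ha : 0 < a)
    (hy : ∀ x, a ≤ x → x ≤ b → x < s * x + c ∧ s * x + c < 1)
    (h : ∀ x, a ≤ x → x ≤ b → 1 / x + s ^ 2 / (1 - (s * x + c)) +
      d * (s - 1) ^ 2 / ((s * x + c) - x) ≤ (d - 1) / (1 - x) + (d - 1) * s ^ 2 / (s * x + c))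
    (hax : a ≤ x) (hxb : x ≤ b) :
    rate d x (s * x + c) ≤ max (rate d a (s * a + c)) (rate d b (s * b + c)) := by
  have hab := hax.trans hxb
  refine (convexOn_rate ha hy h).le_on_segment (Set.left_mem_Icc.2 hab) (Set.right_mem_Icc.2 hab) ?_
  rw [segment_eq_Icc hab]
  exact ⟨hax, hxb⟩

/-- The rate near zero along a line through the origin. -/
theorem rate_le_near_zero {d s x : ℝ} (hs : 1 < s) (hds : 2 ≤ d - 1 - s) (hx : 0 < x)
    (hsx : s * x ≤ 1 / 2) :
    rate d x (s * x) ≤ 2 * (x * log x) +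
      ((d - 1) * (s * log s) - d * ((s - 1) * log (s - 1)) + s) * x := by
  have hx1 : x < 1 := by nlinarith
  have h1 : log (s * x) = log s + log x := log_mul (by linarith) hx.ne'
  have h2 : log (s * x - x) = log (s - 1) + log x := by
    rw [← log_mul (by linarith) hx.ne']; ring_nf
  have h3 : log (1 - x) ≤ 0 := log_nonpos (by linarith) (by linarith)
  have h4 : -(s * x) ≤ (1 - s * x) * log (1 - s * x) := by
    have hpos : 0 < 1 - s * x := by linarith
    have := mul_le_mul_of_nonneg_left (one_sub_inv_le_log_of_pos hpos) hpos.le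
    rw [mul_sub, mul_inv_cancel₀ hpos.ne'] at this
    linarith
  have h5 : x * log x ≤ 0 := mul_nonpos_of_nonneg_of_nonpos hx.le (log_nonpos hx.le hx1.le)
  have h6 : (d - 1) * ((1 - x) * log (1 - x)) ≤ 0 :=
    mul_nonpos_of_nonneg_of_nonpos (by linarith)
      (mul_nonpos_of_nonneg_of_nonpos (by linarith) h3)
  -- The total coefficient of `x * log x` is `(d - 1) * s - d * (s - 1) - 1 = d - 1 - s`.
  have h7 : (d - 1 - s) * (x * log x) ≤ 2 * (x * log x) := by nlinarith
  rw [rate, h1, h2]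
  nlinarith

/-- The reciprocal of a positive affine function is convex, hence below its chord; the right side is
that chord in closed form. -/
theorem one_div_affine_le_secant {m k a b x : ℝ} (ha : 0 < m * a + k) (hb : 0 < m * b + k)
    (hax : a ≤ x) (hxb : x ≤ b) :
    1 / (m * x + k) ≤ (m * (a + b - x) + k) / ((m * a + k) * (m * b + k)) := by
  have hx : 0 < m * x + k := by
    rcases le_total 0 m with h | h <;> nlinarith
  rw [div_le_div_iff₀ hx (mul_pos ha hb)]
  nlinarith [mul_nonneg (sq_nonneg m) (mul_nonneg (sub_nonneg.2 hax) (sub_nonneg.2 hxb))]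

theorem tangent_le_one_div {t r : ℝ} (ht : 0 < t) (hr : 0 < r) : (2 * r - t) / r ^ 2 ≤ 1 / t := by
  rw [div_le_div_iff₀ (by positivity) ht]
  nlinarith [sq_nonneg (r - t)]

/-- The rate along a line is at most its maximum at the ends of an interval if a linear lower bound
for its second derivative is nonnegative there. -/
theorem rate_le_max_of_secant {d s c a b x : ℝ} (ha : 0 < a) (hd : 1 ≤ d)
    (hya : a < s * a + c) (hyb : b < s * b + c) (hya' : s * a + c < 1) (hyb' : s * b + c < 1)
    (hlin : ∀ x, a ≤ x → x ≤ b →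
      (a + b - x) / (a * b) + s ^ 2 * ((-s * (a + b - x) + (1 - c)) /
          ((-s * a + (1 - c)) * (-s * b + (1 - c)))) +
        d * (s - 1) ^ 2 * (((s - 1) * (a + b - x) + c) / (((s - 1) * a + c) * ((s - 1) * b + c)))
      ≤ (d - 1) * ((2 * (1 - (a + b) / 2) - (1 - x)) / (1 - (a + b) / 2) ^ 2) +
        (d - 1) * s ^ 2 * ((2 * (s * ((a + b) / 2) + c) - (s * x + c)) /
          (s * ((a + b) / 2) + c) ^ 2))
    (hax : a ≤ x) (hxb : x ≤ b) :
    rate d x (s * x + c) ≤ max (rate d a (s * a + c)) (rate d b (s * b + c)) := by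
  have hab := hax.trans hxb
  have hy : ∀ x, a ≤ x → x ≤ b → x < s * x + c ∧ s * x + c < 1 := by
    intro x h1 h2
    constructor
    · rcases le_total 1 s with h | h <;> nlinarith
    · rcases le_total 0 s with h | h <;> nlinarith
  refine rate_le_max ha hy (fun x h1 h2 => ?_) hax hxb
  obtain ⟨h3, h4⟩ := hy x h1 h2
  -- Negative terms of the second derivative are bounded by chords, positive ones by tangents at the
  -- midpoint, leaving a condition linear in `x`.
  have k1 := one_div_affine_le_secant (m := 1) (k := 0) (by linarith) (by linarith) h1 h2
  have k2 := one_div_affine_le_secant (m := -s) (k := 1 - c) (by linarith) (by linarith) h1 h2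
  have k3 := one_div_affine_le_secant (m := s - 1) (k := c) (by linarith) (by linarith) h1 h2
  have k4 := tangent_le_one_div (show 0 < 1 - x by linarith)
    (show 0 < 1 - (a + b) / 2 by linarith)
  have k5 := tangent_le_one_div (show 0 < s * x + c by linarith)
    (show 0 < s * ((a + b) / 2) + c by linarith)
  simp only [one_mul, add_zero] at k1
  have k2 := mul_le_mul_of_nonneg_left k2 (sq_nonneg s)
  have k3 := mul_le_mul_of_nonneg_left k3
    (mul_nonneg (show 0 ≤ d by linarith) (sq_nonneg (s - 1)))
  have k4 := mul_le_mul_of_nonneg_left k4 (show 0 ≤ d - 1 by linarith)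
  have k5 := mul_le_mul_of_nonneg_left k5
    (mul_nonneg (show 0 ≤ d - 1 by linarith) (sq_nonneg s))
  rw [mul_one_div] at k2 k3 k4 k5
  rw [show -s * x + (1 - c) = 1 - (s * x + c) by ring] at k2
  rw [show (s - 1) * x + c = s * x + c - x by ring] at k3
  linarith [hlin x h1 h2]

/-- The left end `a` may be arbitrarily small, so numerical chords are of no use. On a ray the
singular terms of the second derivative combine to `(d - 1 - s) / x`, and `hb` says exactly that
this dominates `s ^ 2 / (1 - s * x)` at `x = b`. -/
theorem rate_le_max_of_ray {d s a b x : ℝ} (ha : 0 < a) (hs : 1 < s) (hd : 1 ≤ d)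
    (hb : b * (s * (d - 1)) ≤ d - 1 - s) (hsb : s * b < 1) (hax : a ≤ x) (hxb : x ≤ b) :
    rate d x (s * x) ≤ max (rate d a (s * a)) (rate d b (s * b)) := by
  have := rate_le_max (d := d) (s := s) (c := 0) (a := a) (b := b) (x := x) ha ?_ ?_ hax hxb
  · simpa only [add_zero] using this
  · intro x h1 h2
    constructor <;> nlinarith
  · intro x h1 h2
    have hx : 0 < x := by linarith
    have hsx : s * x < 1 := by nlinarith
    have hx1 : x < 1 := by nlinarith
    have key : s ^ 2 / (1 - s * x) ≤ (d - 1 - s) / x := by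
      rw [div_le_div_iff₀ (by linarith) hx]
      have : x * (s * (d - 1)) ≤ b * (s * (d - 1)) :=
        mul_le_mul_of_nonneg_right h2 (mul_nonneg (by linarith) (by linarith))
      nlinarith
    have h0 : 0 ≤ (d - 1) / (1 - x) := div_nonneg (by linarith) (by linarith)
    have hs1 : s - 1 ≠ 0 := by linarith
    have e1 : d * (s - 1) ^ 2 / (s * x + 0 - x) = d * (s - 1) / x := by
      rw [show s * x + 0 - x = (s - 1) * x by ring]
      field_simp
    have e2 : (d - 1) * s ^ 2 / (s * x + 0) = (d - 1) * s / x := by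
      rw [add_zero]
      field_simp
    rw [e1, e2, add_zero]
    have e3 : (d - 1 - s) / x = (d - 1) * s / x - d * (s - 1) / x - 1 / x := by
      field_simp
      ring
    linarith

/-- Negativity of the rate at a rational point, as an inequality between natural numbers. -/
theorem rate_neg {k p a b : ℕ} (hp : 0 < p) (ha : 0 < a) (hb : 0 < b)
    (h : (a + b) ^ ((k + 1) * (a + b)) * (p + a) ^ ((k + 1) * (p + a))
      < (p + a + b) ^ (k * (p + a + b)) * p ^ p * b ^ b * a ^ ((k + 2) * a)) :
    rate ((k + 2 : ℕ) : ℝ) (p / (p + a + b)) ((p + a) / (p + a + b)) < 0 := by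
  have hp' : (0 : ℝ) < p := by exact_mod_cast hp
  have ha' : (0 : ℝ) < a := by exact_mod_cast ha
  have hb' : (0 : ℝ) < b := by exact_mod_cast hb
  have hcast : (a + b : ℝ) ^ ((k + 1) * (a + b)) * (p + a : ℝ) ^ ((k + 1) * (p + a))
      < (p + a + b : ℝ) ^ (k * (p + a + b)) * (p : ℝ) ^ p * (b : ℝ) ^ b
        * (a : ℝ) ^ ((k + 2) * a) := by
    exact_mod_cast h
  have hlog := log_lt_log (by positivity) hcast
  rw [log_mul (by positivity) (by positivity), log_mul (by positivity) (by positivity),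
    log_mul (by positivity) (by positivity), log_mul (by positivity) (by positivity)] at hlog
  simp only [log_pow] at hlog
  push_cast at hlog
  set N : ℝ := p + a + b with hN
  have hN0 : 0 < N := by positivity
  have e1 : 1 - p / N = (a + b) / N := by field_simp; rw [hN]; ring
  have e2 : 1 - (p + a) / N = b / N := by field_simp; rw [hN]; ring
  have e3 : (p + a) / N - p / N = a / N := by field_simp; ring
  -- The terms in `log N` have total weight `-(d - 2) * N`; writing `d = k + 2` keeps the exponents
  -- natural.
  have hmul : N * rate ((k + 2 : ℕ) : ℝ) (p / N) ((p + a) / N)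
      = (k + 1) * (a + b) * log (a + b) + (k + 1) * (p + a) * log (p + a)
        - (k * N * log N + p * log p + b * log b + (k + 2) * a * log a) := by
    rw [rate, e1, e2, e3, log_div hp'.ne' hN0.ne', log_div (by positivity) hN0.ne',
      log_div (by positivity) hN0.ne', log_div hb'.ne' hN0.ne', log_div ha'.ne' hN0.ne']
    push_cast
    field_simp
    rw [hN]
    ring
  by_contra hc
  nlinarith [mul_nonneg hN0.le (not_lt.1 hc)]

end BipartiteExpander

namespace BipartiteExpander

open Finset Real Filter Topology

/-! ### The four profiles -/

/-- The rate is bounded away from zero at the breakpoints of `f5` up to `1 / 2`. -/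
theorem exists_rate_le_neg_f5 : ∃ δ > 0, rate (5 : ℕ) (3 / 20) (3 / 10) ≤ -δ ∧
    rate (5 : ℕ) (3 / 10) (1 / 2) ≤ -δ ∧
    rate (5 : ℕ) (1 / 2) (7 / 10) ≤ -δ := by
  have h1 : rate (5 : ℕ) (3 / 20) (3 / 10) < 0 := by
    -- `p : a : b` is `x : y - x : 1 - y` over a common denominator.
    have := rate_neg (k := 3) (p := 3) (a := 3) (b := 14) (by norm_num) (by norm_num)
      (by norm_num) (by norm_num)
    norm_num at this ⊢
    exact this
  have h2 : rate (5 : ℕ) (3 / 10) (1 / 2) < 0 := by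
    have := rate_neg (k := 3) (p := 3) (a := 2) (b := 5) (by norm_num) (by norm_num)
      (by norm_num) (by norm_num)
    norm_num at this ⊢
    exact this
  have h3 : rate (5 : ℕ) (1 / 2) (7 / 10) < 0 := by
    have := rate_neg (k := 3) (p := 5) (a := 2) (b := 3) (by norm_num) (by norm_num)
      (by norm_num) (by norm_num)
    norm_num at this ⊢
    exact this
  refine ⟨-(max (rate (5 : ℕ) (1 / 2) (7 / 10))
    (max (rate (5 : ℕ) (3 / 10) (1 / 2))
    ((rate (5 : ℕ) (3 / 20) (3 / 10))))), ?_, ?_⟩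
  · exact neg_pos.2 (max_lt h3 (max_lt h2 h1))
  · simp

theorem exists_perm_f5 : ∃ v₀ : ℕ, ∀ v : ℕ, v₀ ≤ v → ∃ σ : Equiv.Perm (Fin v × Fin 5),
    ∀ A, 0 < #A → #A ≤ (1 / 2 : ℝ) * v →
      f5 1 (#A / v) * v ≤ #(permNeighbours σ A) ∧
      f5 1 (#A / v) * v ≤ #(permNeighbours σ⁻¹ A) := by
  obtain ⟨δ, hδ, h1, h2, h3⟩ := exists_rate_le_neg_f5
  have hray : ∀ x ≤ (3 / 20 : ℝ), f5 1 x = 2 * x := by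
    intro x hx
    rw [f5, if_pos (by linarith)]
  -- `ε` is the length of the initial ray, and `K` is the constant of `rate_le_near_zero` for its
  -- slope.
  refine exists_perm_of_rate (ε := 3 / 20) (δ := δ)
    (K := (((5 : ℕ) : ℝ) - 1) * (2 * log (2)) -
      ((5 : ℕ) : ℝ) * ((2 - 1) * log (2 - 1)) + 2)
    (by norm_num) (by norm_num) (by norm_num) hδ ?_ ?_ (fun x hx0 hx => ?_)
  · intro x hx0 hx
    simp only [f5]
    split_ifs <;> constructor <;> linarith
  · intro a x ha0 ha hax hx
    rw [hray a ha]
    rcases le_total x (3 / 20) with hx1 | hx1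
    · rw [hray x hx1]
      refine (rate_le_max_of_ray ha0 (by norm_num) (by norm_num) (b := 3 / 20)
        (by norm_num) (by norm_num) hax hx1).trans (max_le_max le_rfl ?_)
      norm_num at h1 ⊢
      exact h1
    refine le_max_of_le_right ?_
    rcases le_total x (3 / 10) with hx2 | hx2
    · have hfx : f5 1 x = 4 / 3 * x + 1 / 10 := by
        rw [f5]
        split_ifs <;> linarith
      rw [hfx]
      refine (rate_le_max_of_secant (a := 3 / 20) (b := 3 / 10) (by norm_num) (by norm_num) (by norm_num)
        (by norm_num) (by norm_num) (by norm_num) ?_ hx1 hx2).trans (max_le ?_ ?_)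
      · intro x hx hx'
        norm_num
        linarith
      · norm_num at h1 ⊢
        exact h1
      · norm_num at h2 ⊢
        exact h2
    have hfx : f5 1 x = 1 * x + 1 / 5 := by
      rw [f5]
      split_ifs <;> linarith
    rw [hfx]
    refine (rate_le_max_of_secant (a := 3 / 10) (b := 1 / 2) (by norm_num) (by norm_num) (by norm_num)
      (by norm_num) (by norm_num) (by norm_num) ?_ hx2 hx).trans (max_le ?_ ?_)
    · intro x hx hx'
      norm_num
      linarith
    · norm_num at h2 ⊢
      exact h2
    · norm_num at h3 ⊢
      exact h3
  · rw [hray x hx]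
    exact rate_le_near_zero (by norm_num) (by norm_num) hx0 (by linarith)

/-- The profile is strictly increasing and its graph is symmetric under `(x, y) ↦ (1 - y, 1 - x)`.
-/
theorem f5_dual {x t : ℝ} (hx : 1 / 2 < x) (h : 1 - f5 1 x < t) (ht : t ≤ 1 / 2) :
    1 - x < f5 1 t := by
  simp only [f5] at h ⊢
  split_ifs at h ⊢ <;> linarith

theorem le_f5 {t : ℝ} (ht : 1 / 2 - 1 / 25 ≤ t) (ht1 : t ≤ 1 / 2) : 1 - 1 / 2 ≤ f5 1 t := by
  rw [f5]
  split_ifs <;> linarith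

theorem f5_mul {v : ℝ} (hv : 0 < v) (t : ℝ) : f5 v (t * v) = f5 1 t * v := by
  have h1 (a b : ℝ) : t * v ≤ a * v / b ↔ t ≤ a * 1 / b := by
    rw [mul_one, mul_div_right_comm, mul_le_mul_iff_left₀ hv]
  have h2 (b : ℝ) : t * v ≤ v / b ↔ t ≤ 1 / b := by
    rw [← mul_one_div, mul_comm v, mul_le_mul_iff_left₀ hv]
  simp only [f5, h1, h2]
  split_ifs <;> ring

/-- The rate is bounded away from zero at the breakpoints of `f6` up to `1 / 2`. -/
theorem exists_rate_le_neg_f6 : ∃ δ > 0, rate (6 : ℕ) (1 / 10) (1 / 4) ≤ -δ ∧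
    rate (6 : ℕ) (1 / 4) (1 / 2) ≤ -δ ∧
    rate (6 : ℕ) (1 / 2) (3 / 4) ≤ -δ := by
  have h1 : rate (6 : ℕ) (1 / 10) (1 / 4) < 0 := by
    have := rate_neg (k := 4) (p := 2) (a := 3) (b := 15) (by norm_num) (by norm_num)
      (by norm_num) (by norm_num)
    norm_num at this ⊢
    exact this
  have h2 : rate (6 : ℕ) (1 / 4) (1 / 2) < 0 := by
    have := rate_neg (k := 4) (p := 1) (a := 1) (b := 2) (by norm_num) (by norm_num)
      (by norm_num) (by norm_num)
    norm_num at this ⊢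
    exact this
  have h3 : rate (6 : ℕ) (1 / 2) (3 / 4) < 0 := by
    have := rate_neg (k := 4) (p := 2) (a := 1) (b := 1) (by norm_num) (by norm_num)
      (by norm_num) (by norm_num)
    norm_num at this ⊢
    exact this
  refine ⟨-(max (rate (6 : ℕ) (1 / 2) (3 / 4))
    (max (rate (6 : ℕ) (1 / 4) (1 / 2))
    ((rate (6 : ℕ) (1 / 10) (1 / 4))))), ?_, ?_⟩
  · exact neg_pos.2 (max_lt h3 (max_lt h2 h1))
  · simp

theorem exists_perm_f6 : ∃ v₀ : ℕ, ∀ v : ℕ, v₀ ≤ v → ∃ σ : Equiv.Perm (Fin v × Fin 6),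
    ∀ A, 0 < #A → #A ≤ (1 / 2 : ℝ) * v →
      f6 1 (#A / v) * v ≤ #(permNeighbours σ A) ∧
      f6 1 (#A / v) * v ≤ #(permNeighbours σ⁻¹ A) := by
  obtain ⟨δ, hδ, h1, h2, h3⟩ := exists_rate_le_neg_f6
  have hray : ∀ x ≤ (1 / 10 : ℝ), f6 1 x = 5 / 2 * x := by
    intro x hx
    rw [f6, if_pos (by linarith)]
    ring
  refine exists_perm_of_rate (ε := 1 / 10) (δ := δ)
    (K := (((6 : ℕ) : ℝ) - 1) * (5 / 2 * log (5 / 2)) -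
      ((6 : ℕ) : ℝ) * ((5 / 2 - 1) * log (5 / 2 - 1)) + 5 / 2)
    (by norm_num) (by norm_num) (by norm_num) hδ ?_ ?_ (fun x hx0 hx => ?_)
  · intro x hx0 hx
    simp only [f6]
    split_ifs <;> constructor <;> linarith
  · intro a x ha0 ha hax hx
    rw [hray a ha]
    rcases le_total x (1 / 10) with hx1 | hx1
    · rw [hray x hx1]
      refine (rate_le_max_of_ray ha0 (by norm_num) (by norm_num) (b := 1 / 10)
        (by norm_num) (by norm_num) hax hx1).trans (max_le_max le_rfl ?_)
      norm_num at h1 ⊢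
      exact h1
    refine le_max_of_le_right ?_
    rcases le_total x (1 / 4) with hx2 | hx2
    · have hfx : f6 1 x = 5 / 3 * x + 1 / 12 := by
        rw [f6]
        split_ifs <;> linarith
      rw [hfx]
      refine (rate_le_max_of_secant (a := 1 / 10) (b := 1 / 4) (by norm_num) (by norm_num) (by norm_num)
        (by norm_num) (by norm_num) (by norm_num) ?_ hx1 hx2).trans (max_le ?_ ?_)
      · intro x hx hx'
        norm_num
        linarith
      · norm_num at h1 ⊢
        exact h1
      · norm_num at h2 ⊢
        exact h2
    have hfx : f6 1 x = 1 * x + 1 / 4 := by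
      rw [f6]
      split_ifs <;> linarith
    rw [hfx]
    refine (rate_le_max_of_secant (a := 1 / 4) (b := 1 / 2) (by norm_num) (by norm_num) (by norm_num)
      (by norm_num) (by norm_num) (by norm_num) ?_ hx2 hx).trans (max_le ?_ ?_)
    · intro x hx hx'
      norm_num
      linarith
    · norm_num at h2 ⊢
      exact h2
    · norm_num at h3 ⊢
      exact h3
  · rw [hray x hx]
    exact rate_le_near_zero (by norm_num) (by norm_num) hx0 (by linarith)

theorem f6_dual {x t : ℝ} (hx : 1 / 2 < x) (h : 1 - f6 1 x < t) (ht : t ≤ 1 / 2) :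
    1 - x < f6 1 t := by
  simp only [f6] at h ⊢
  split_ifs at h ⊢ <;> linarith

theorem le_f6 {t : ℝ} (ht : 1 / 2 - 1 / 25 ≤ t) (ht1 : t ≤ 1 / 2) : 1 - 1 / 2 ≤ f6 1 t := by
  rw [f6]
  split_ifs <;> linarith

theorem f6_mul {v : ℝ} (hv : 0 < v) (t : ℝ) : f6 v (t * v) = f6 1 t * v := by
  have h1 (a b : ℝ) : t * v ≤ a * v / b ↔ t ≤ a * 1 / b := by
    rw [mul_one, mul_div_right_comm, mul_le_mul_iff_left₀ hv]
  have h2 (b : ℝ) : t * v ≤ v / b ↔ t ≤ 1 / b := by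
    rw [← mul_one_div, mul_comm v, mul_le_mul_iff_left₀ hv]
  simp only [f6, h1, h2]
  split_ifs <;> ring

set_option exponentiation.threshold 1000 in
/-- The rate is bounded away from zero at the breakpoints of `f7` up to `39 / 100`. -/
theorem exists_rate_le_neg_f7 : ∃ δ > 0, rate (7 : ℕ) (1 / 10) (3 / 10) ≤ -δ ∧
    rate (7 : ℕ) (3 / 20) (2 / 5) ≤ -δ ∧
    rate (7 : ℕ) (3 / 10) (61 / 100) ≤ -δ ∧
    rate (7 : ℕ) (39 / 100) (7 / 10) ≤ -δ := by
  have h1 : rate (7 : ℕ) (1 / 10) (3 / 10) < 0 := by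
    have := rate_neg (k := 5) (p := 1) (a := 2) (b := 7) (by norm_num) (by norm_num)
      (by norm_num) (by norm_num)
    norm_num at this ⊢
    exact this
  have h2 : rate (7 : ℕ) (3 / 20) (2 / 5) < 0 := by
    have := rate_neg (k := 5) (p := 3) (a := 5) (b := 12) (by norm_num) (by norm_num)
      (by norm_num) (by norm_num)
    norm_num at this ⊢
    exact this
  have h3 : rate (7 : ℕ) (3 / 10) (61 / 100) < 0 := by
    have := rate_neg (k := 5) (p := 30) (a := 31) (b := 39) (by norm_num) (by norm_num)
      (by norm_num) (by norm_num)
    norm_num at this ⊢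
    exact this
  have h4 : rate (7 : ℕ) (39 / 100) (7 / 10) < 0 := by
    have := rate_neg (k := 5) (p := 39) (a := 31) (b := 30) (by norm_num) (by norm_num)
      (by norm_num) (by norm_num)
    norm_num at this ⊢
    exact this
  refine ⟨-(max (rate (7 : ℕ) (39 / 100) (7 / 10))
    (max (rate (7 : ℕ) (3 / 10) (61 / 100))
    (max (rate (7 : ℕ) (3 / 20) (2 / 5))
    ((rate (7 : ℕ) (1 / 10) (3 / 10)))))), ?_, ?_⟩
  · exact neg_pos.2 (max_lt h4 (max_lt h3 (max_lt h2 h1)))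
  · simp

/-- The cutoff `39 / 100` ends the piece of slope one, which the symmetry maps to itself; everything
to its right mirrors the part left of `3 / 10`. -/
theorem exists_perm_f7 : ∃ v₀ : ℕ, ∀ v : ℕ, v₀ ≤ v → ∃ σ : Equiv.Perm (Fin v × Fin 7),
    ∀ A, 0 < #A → #A ≤ (39 / 100 : ℝ) * v →
      f7 1 (#A / v) * v ≤ #(permNeighbours σ A) ∧
      f7 1 (#A / v) * v ≤ #(permNeighbours σ⁻¹ A) := by
  obtain ⟨δ, hδ, h1, h2, h3, h4⟩ := exists_rate_le_neg_f7
  have hray : ∀ x ≤ (1 / 10 : ℝ), f7 1 x = 3 * x := by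
    intro x hx
    rw [f7, if_pos (by linarith)]
  refine exists_perm_of_rate (ε := 1 / 10) (δ := δ)
    (K := (((7 : ℕ) : ℝ) - 1) * (3 * log (3)) -
      ((7 : ℕ) : ℝ) * ((3 - 1) * log (3 - 1)) + 3)
    (by norm_num) (by norm_num) (by norm_num) hδ ?_ ?_ (fun x hx0 hx => ?_)
  · intro x hx0 hx
    simp only [f7]
    split_ifs <;> constructor <;> linarith
  · intro a x ha0 ha hax hx
    rw [hray a ha]
    rcases le_total x (1 / 10) with hx1 | hx1
    · rw [hray x hx1]
      refine (rate_le_max_of_ray ha0 (by norm_num) (by norm_num) (b := 1 / 10)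
        (by norm_num) (by norm_num) hax hx1).trans (max_le_max le_rfl ?_)
      norm_num at h1 ⊢
      exact h1
    refine le_max_of_le_right ?_
    rcases le_total x (3 / 20) with hx2 | hx2
    · have hfx : f7 1 x = 2 * x + 1 / 10 := by
        rw [f7]
        split_ifs <;> linarith
      rw [hfx]
      refine (rate_le_max_of_secant (a := 1 / 10) (b := 3 / 20) (by norm_num) (by norm_num) (by norm_num)
        (by norm_num) (by norm_num) (by norm_num) ?_ hx1 hx2).trans (max_le ?_ ?_)
      · intro x hx hx'
        norm_num
        linarith
      · norm_num at h1 ⊢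
        exact h1
      · norm_num at h2 ⊢
        exact h2
    rcases le_total x (3 / 10) with hx3 | hx3
    · have hfx : f7 1 x = 7 / 5 * x + 19 / 100 := by
        rw [f7]
        split_ifs <;> linarith
      rw [hfx]
      refine (rate_le_max_of_secant (a := 3 / 20) (b := 3 / 10) (by norm_num) (by norm_num) (by norm_num)
        (by norm_num) (by norm_num) (by norm_num) ?_ hx2 hx3).trans (max_le ?_ ?_)
      · intro x hx hx'
        norm_num
        linarith
      · norm_num at h2 ⊢
        exact h2
      · norm_num at h3 ⊢
        exact h3
    have hfx : f7 1 x = 1 * x + 31 / 100 := by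
      rw [f7]
      split_ifs <;> linarith
    rw [hfx]
    refine (rate_le_max_of_secant (a := 3 / 10) (b := 39 / 100) (by norm_num) (by norm_num) (by norm_num)
      (by norm_num) (by norm_num) (by norm_num) ?_ hx3 hx).trans (max_le ?_ ?_)
    · intro x hx hx'
      norm_num
      linarith
    · norm_num at h3 ⊢
      exact h3
    · norm_num at h4 ⊢
      exact h4
  · rw [hray x hx]
    exact rate_le_near_zero (by norm_num) (by norm_num) hx0 (by linarith)

theorem f7_dual {x t : ℝ} (hx : 39 / 100 < x) (h : 1 - f7 1 x < t) (ht : t ≤ 39 / 100) :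
    1 - x < f7 1 t := by
  simp only [f7] at h ⊢
  split_ifs at h ⊢ <;> linarith

theorem le_f7 {t : ℝ} (ht : 39 / 100 - 1 / 25 ≤ t) (ht1 : t ≤ 39 / 100) : 1 - 39 / 100 ≤ f7 1 t := by
  rw [f7]
  split_ifs <;> linarith

theorem f7_mul {v : ℝ} (hv : 0 < v) (t : ℝ) : f7 v (t * v) = f7 1 t * v := by
  have h1 (a b : ℝ) : t * v ≤ a * v / b ↔ t ≤ a * 1 / b := by
    rw [mul_one, mul_div_right_comm, mul_le_mul_iff_left₀ hv]
  have h2 (b : ℝ) : t * v ≤ v / b ↔ t ≤ 1 / b := by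
    rw [← mul_one_div, mul_comm v, mul_le_mul_iff_left₀ hv]
  simp only [f7, h1, h2]
  split_ifs <;> ring

/-- The rate is bounded away from zero at the breakpoints of `f8` up to `1 / 2`. -/
theorem exists_rate_le_neg_f8 : ∃ δ > 0, rate (8 : ℕ) (1 / 10) (3 / 10) ≤ -δ ∧
    rate (8 : ℕ) (1 / 5) (1 / 2) ≤ -δ ∧
    rate (8 : ℕ) (1 / 3) (2 / 3) ≤ -δ ∧
    rate (8 : ℕ) (1 / 2) (4 / 5) ≤ -δ := by
  have h1 : rate (8 : ℕ) (1 / 10) (3 / 10) < 0 := by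
    have := rate_neg (k := 6) (p := 1) (a := 2) (b := 7) (by norm_num) (by norm_num)
      (by norm_num) (by norm_num)
    norm_num at this ⊢
    exact this
  have h2 : rate (8 : ℕ) (1 / 5) (1 / 2) < 0 := by
    have := rate_neg (k := 6) (p := 2) (a := 3) (b := 5) (by norm_num) (by norm_num)
      (by norm_num) (by norm_num)
    norm_num at this ⊢
    exact this
  have h3 : rate (8 : ℕ) (1 / 3) (2 / 3) < 0 := by
    have := rate_neg (k := 6) (p := 1) (a := 1) (b := 1) (by norm_num) (by norm_num)
      (by norm_num) (by norm_num)
    norm_num at this ⊢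
    exact this
  have h4 : rate (8 : ℕ) (1 / 2) (4 / 5) < 0 := by
    have := rate_neg (k := 6) (p := 5) (a := 3) (b := 2) (by norm_num) (by norm_num)
      (by norm_num) (by norm_num)
    norm_num at this ⊢
    exact this
  refine ⟨-(max (rate (8 : ℕ) (1 / 2) (4 / 5))
    (max (rate (8 : ℕ) (1 / 3) (2 / 3))
    (max (rate (8 : ℕ) (1 / 5) (1 / 2))
    ((rate (8 : ℕ) (1 / 10) (3 / 10)))))), ?_, ?_⟩
  · exact neg_pos.2 (max_lt h4 (max_lt h3 (max_lt h2 h1)))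
  · simp

/-- At the cutoff `1 / 2` the profile equals `4 / 5`, exactly the cap allowed by
`exists_perm_of_rate`. -/
theorem exists_perm_f8 : ∃ v₀ : ℕ, ∀ v : ℕ, v₀ ≤ v → ∃ σ : Equiv.Perm (Fin v × Fin 8),
    ∀ A, 0 < #A → #A ≤ (1 / 2 : ℝ) * v →
      f8 1 (#A / v) * v ≤ #(permNeighbours σ A) ∧
      f8 1 (#A / v) * v ≤ #(permNeighbours σ⁻¹ A) := by
  obtain ⟨δ, hδ, h1, h2, h3, h4⟩ := exists_rate_le_neg_f8
  have hray : ∀ x ≤ (1 / 10 : ℝ), f8 1 x = 3 * x := by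
    intro x hx
    rw [f8, if_pos (by linarith)]
  refine exists_perm_of_rate (ε := 1 / 10) (δ := δ)
    (K := (((8 : ℕ) : ℝ) - 1) * (3 * log (3)) -
      ((8 : ℕ) : ℝ) * ((3 - 1) * log (3 - 1)) + 3)
    (by norm_num) (by norm_num) (by norm_num) hδ ?_ ?_ (fun x hx0 hx => ?_)
  · intro x hx0 hx
    simp only [f8]
    split_ifs <;> constructor <;> linarith
  · intro a x ha0 ha hax hx
    rw [hray a ha]
    rcases le_total x (1 / 10) with hx1 | hx1
    · rw [hray x hx1]
      refine (rate_le_max_of_ray ha0 (by norm_num) (by norm_num) (b := 1 / 10)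
        (by norm_num) (by norm_num) hax hx1).trans (max_le_max le_rfl ?_)
      norm_num at h1 ⊢
      exact h1
    refine le_max_of_le_right ?_
    rcases le_total x (1 / 5) with hx2 | hx2
    · have hfx : f8 1 x = 2 * x + 1 / 10 := by
        rw [f8]
        split_ifs <;> linarith
      rw [hfx]
      refine (rate_le_max_of_secant (a := 1 / 10) (b := 1 / 5) (by norm_num) (by norm_num) (by norm_num)
        (by norm_num) (by norm_num) (by norm_num) ?_ hx1 hx2).trans (max_le ?_ ?_)
      · intro x hx hx'
        norm_num
        linarith
      · norm_num at h1 ⊢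
        exact h1
      · norm_num at h2 ⊢
        exact h2
    rcases le_total x (1 / 3) with hx3 | hx3
    · have hfx : f8 1 x = 5 / 4 * x + 1 / 4 := by
        rw [f8]
        split_ifs <;> linarith
      rw [hfx]
      refine (rate_le_max_of_secant (a := 1 / 5) (b := 1 / 3) (by norm_num) (by norm_num) (by norm_num)
        (by norm_num) (by norm_num) (by norm_num) ?_ hx2 hx3).trans (max_le ?_ ?_)
      · intro x hx hx'
        norm_num
        linarith
      · norm_num at h2 ⊢
        exact h2
      · norm_num at h3 ⊢
        exact h3
    have hfx : f8 1 x = 4 / 5 * x + 2 / 5 := by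
      rw [f8]
      split_ifs <;> linarith
    rw [hfx]
    refine (rate_le_max_of_secant (a := 1 / 3) (b := 1 / 2) (by norm_num) (by norm_num) (by norm_num)
      (by norm_num) (by norm_num) (by norm_num) ?_ hx3 hx).trans (max_le ?_ ?_)
    · intro x hx hx'
      norm_num
      linarith
    · norm_num at h3 ⊢
      exact h3
    · norm_num at h4 ⊢
      exact h4
  · rw [hray x hx]
    exact rate_le_near_zero (by norm_num) (by norm_num) hx0 (by linarith)

theorem f8_dual {x t : ℝ} (hx : 1 / 2 < x) (h : 1 - f8 1 x < t) (ht : t ≤ 1 / 2) :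
    1 - x < f8 1 t := by
  simp only [f8] at h ⊢
  split_ifs at h ⊢ <;> linarith

theorem le_f8 {t : ℝ} (ht : 1 / 2 - 1 / 25 ≤ t) (ht1 : t ≤ 1 / 2) : 1 - 1 / 2 ≤ f8 1 t := by
  rw [f8]
  split_ifs <;> linarith

theorem f8_mul {v : ℝ} (hv : 0 < v) (t : ℝ) : f8 v (t * v) = f8 1 t * v := by
  have h1 (a b : ℝ) : t * v ≤ a * v / b ↔ t ≤ a * 1 / b := by
    rw [mul_one, mul_div_right_comm, mul_le_mul_iff_left₀ hv]
  have h2 (b : ℝ) : t * v ≤ v / b ↔ t ≤ 1 / b := by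
    rw [← mul_one_div, mul_comm v, mul_le_mul_iff_left₀ hv]
  simp only [f8, h1, h2]
  split_ifs <;> ring

/-! ### Large sets by duality -/

theorem le_card_permNeighbours_of_dual {v d : ℕ} {F : ℝ → ℝ} {x₁ : ℝ} (hv : 25 ≤ v)
    (hx₁ : 1 / 25 < x₁) (hF0 : F 0 = 0)
    (hdual : ∀ x t, x₁ < x → 1 - F x < t → t ≤ x₁ → 1 - x < F t)
    (hmid : ∀ t, x₁ - 1 / 25 ≤ t → t ≤ x₁ → 1 - x₁ ≤ F t) (σ : Equiv.Perm (Fin v × Fin d))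
    (hσ : ∀ A, 0 < #A → #A ≤ x₁ * v →
      F (#A / v) * v ≤ #(permNeighbours σ A) ∧ F (#A / v) * v ≤ #(permNeighbours σ⁻¹ A))
    (A : Finset (Fin v)) : F (#A / v) * v ≤ #(permNeighbours σ A) := by
  have hv' : (25 : ℝ) ≤ v := by exact_mod_cast hv
  have hv0 : (0 : ℝ) < v := by linarith
  rcases Nat.eq_zero_or_pos #A with hA | hA
  · rw [hA]
    simp [hF0]
  rcases le_or_gt (#A : ℝ) (x₁ * v) with hAx | hAx
  · exact (hσ A hA hAx).1
  by_contra! hlt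
  have hcA : (#A : ℝ) ≤ v := by exact_mod_cast (card_le_univ A).trans_eq (Fintype.card_fin v)
  set B := (permNeighbours σ A)ᶜ with hB
  have hcB : (#B : ℝ) = v - #(permNeighbours σ A) := by
    rw [hB, card_compl, Fintype.card_fin, Nat.cast_sub]
    exact (card_le_univ _).trans_eq (Fintype.card_fin v)
  have hsub : ∀ C ⊆ B, (#(permNeighbours σ⁻¹ C) : ℝ) ≤ v - #A := by
    intro C hC
    have h := card_le_card ((permNeighbours_mono σ⁻¹ hC).trans
      (permNeighbours_inv_compl_subset σ A))
    rw [card_compl, Fintype.card_fin] at h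
    have h' : #(permNeighbours σ⁻¹ C) + #A ≤ v := by
      have : #A ≤ v := by exact_mod_cast hcA
      omega
    have : (#(permNeighbours σ⁻¹ C) : ℝ) + #A ≤ v := by exact_mod_cast h'
    linarith
  have hx : x₁ < #A / v := (lt_div_iff₀ hv0).2 hAx
  have hx1 : (#A : ℝ) / v ≤ 1 := (div_le_one hv0).2 hcA
  have hAv : (1 - (#A : ℝ) / v) * v = v - #A := by field_simp
  obtain ⟨C, hCB, hC0, hCx, hC⟩ : ∃ C ⊆ B, 0 < #C ∧ (#C : ℝ) ≤ x₁ * v ∧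
      1 - (#A : ℝ) / v < F (#C / v) := by
    rcases le_or_gt (#B : ℝ) (x₁ * v) with hBx | hBx
    · have hF : 1 - (#A : ℝ) / v < F (#B / v) := by
        refine hdual _ _ hx ?_ ((div_le_iff₀ hv0).2 hBx)
        rw [lt_div_iff₀ hv0, hcB, sub_mul, one_mul]
        linarith
      refine ⟨B, subset_rfl, Nat.pos_of_ne_zero fun h0 => ?_, hBx, hF⟩
      rw [h0, Nat.cast_zero, zero_div, hF0] at hF
      linarith
    -- If `B` is too large for `hσ`, a subset of size `⌊x₁ * v⌋₊` suffices. As `25 ≤ v`, its density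
    -- is within `1 / 25` of `x₁`, where `hmid` applies.
    · have hpos : 0 ≤ x₁ * v := by nlinarith
      have hfl : ⌊x₁ * v⌋₊ ≤ #B := Nat.floor_le_of_le hBx.le
      obtain ⟨C, hCB, hC⟩ := exists_subset_card_eq hfl
      have h1 : (#C : ℝ) ≤ x₁ * v := by rw [hC]; exact Nat.floor_le hpos
      have h2 : x₁ * v - 1 < #C := by rw [hC]; linarith [Nat.lt_floor_add_one (x₁ * v)]
      have h3 : (x₁ - 1 / 25) * v ≤ #C := by nlinarith
      refine ⟨C, hCB, ?_, h1, ?_⟩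
      · have : (0 : ℝ) < #C := lt_of_lt_of_le (mul_pos (by linarith) hv0) h3
        exact_mod_cast this
      · have := hmid (#C / v) ((le_div_iff₀ hv0).2 h3) ((div_le_iff₀ hv0).2 h1)
        linarith
  have h1 := (hσ C hC0 hCx).2
  have h2 := hsub C hCB
  have h3 := mul_lt_mul_of_pos_right hC hv0
  linarith

theorem exists_graph_of_perm {d : ℕ} {x₁ : ℝ} (hx₁ : 1 / 25 < x₁) (hF0 : f d 1 0 = 0)
    (hmul : ∀ v : ℝ, 0 < v → ∀ t, f d v (t * v) = f d 1 t * v)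
    (hdual : ∀ x t, x₁ < x → 1 - f d 1 x < t → t ≤ x₁ → 1 - x < f d 1 t)
    (hmid : ∀ t, x₁ - 1 / 25 ≤ t → t ≤ x₁ → 1 - x₁ ≤ f d 1 t)
    (h : ∃ v₀ : ℕ, ∀ v : ℕ, v₀ ≤ v → ∃ σ : Equiv.Perm (Fin v × Fin d),
      ∀ A, 0 < #A → #A ≤ x₁ * v →
        f d 1 (#A / v) * v ≤ #(permNeighbours σ A) ∧
        f d 1 (#A / v) * v ≤ #(permNeighbours σ⁻¹ A)) :
    ∃ v₀ : ℕ, ∀ v : ℕ, v₀ ≤ v →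
      ∃ (α β : Type) (G : Graph α β) (V W : Finset α),
        IsBipartiteWith G V W ∧ V.card = v ∧ W.card = v ∧ IsRegular G d ∧
        ∀ U : Finset α, U ⊆ V ∨ U ⊆ W →
          f d (v : ℝ) (U.card : ℝ) ≤ ((neighbours G U).ncard : ℝ) := by
  obtain ⟨v₀, hv₀⟩ := h
  refine ⟨max v₀ 25, fun v hv => ?_⟩
  obtain ⟨σ, hσ⟩ := hv₀ v ((le_max_left _ _).trans hv)
  have hv25 : 25 ≤ v := (le_max_right _ _).trans hv
  have hv0 : (0 : ℝ) < v := by exact_mod_cast (show 0 < v by omega)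
  refine ⟨_, _, permGraph σ, univ.map .inl, univ.map .inr, isBipartiteWith_permGraph σ, by simp,
    by simp, isRegular_permGraph σ, fun U hU => ?_⟩
  rw [show (#U : ℝ) = #U / v * v by field_simp, hmul _ hv0]
  rcases hU with hU | hU
  · obtain ⟨A, -, rfl⟩ := subset_map_iff.1 hU
    rw [neighbours_permGraph_inl, card_map]
    exact le_card_permNeighbours_of_dual hv25 hx₁ hF0 hdual hmid σ hσ A
  · obtain ⟨A, -, rfl⟩ := subset_map_iff.1 hU
    rw [neighbours_permGraph_inr, card_map]
    refine le_card_permNeighbours_of_dual hv25 hx₁ hF0 hdual hmid σ⁻¹ (fun B h0 h1 => ?_) A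
    rw [inv_inv]
    exact (hσ B h0 h1).symm

end BipartiteExpander

theorem theorem1 (d : ℕ) (hd : d = 5 ∨ d = 6 ∨ d = 7 ∨ d = 8) :
    ∃ v₀ : ℕ, ∀ v : ℕ, v₀ ≤ v →
      ∃ (α β : Type) (G : Graph α β) (V W : Finset α),
        BipartiteExpander.IsBipartiteWith G V W ∧ V.card = v ∧ W.card = v ∧
        BipartiteExpander.IsRegular G d ∧
        ∀ U : Finset α, U ⊆ V ∨ U ⊆ W →
          BipartiteExpander.f d (v : ℝ) (U.card : ℝ)
            ≤ ((BipartiteExpander.neighbours G U).ncard : ℝ) := by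
  rcases hd with rfl | rfl | rfl | rfl
  · exact BipartiteExpander.exists_graph_of_perm (by norm_num)
      (by norm_num [BipartiteExpander.f, BipartiteExpander.f5])
      (fun _ hv t => BipartiteExpander.f5_mul hv t)
      (fun _ _ => BipartiteExpander.f5_dual) (fun _ => BipartiteExpander.le_f5)
      BipartiteExpander.exists_perm_f5
  · exact BipartiteExpander.exists_graph_of_perm (by norm_num)
      (by norm_num [BipartiteExpander.f, BipartiteExpander.f6])
      (fun _ hv t => BipartiteExpander.f6_mul hv t)
      (fun _ _ => BipartiteExpander.f6_dual) (fun _ => BipartiteExpander.le_f6)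
      BipartiteExpander.exists_perm_f6
  · exact BipartiteExpander.exists_graph_of_perm (by norm_num)
      (by norm_num [BipartiteExpander.f, BipartiteExpander.f7])
      (fun _ hv t => BipartiteExpander.f7_mul hv t)
      (fun _ _ => BipartiteExpander.f7_dual) (fun _ => BipartiteExpander.le_f7)
      BipartiteExpander.exists_perm_f7
  · exact BipartiteExpander.exists_graph_of_perm (by norm_num)
      (by norm_num [BipartiteExpander.f, BipartiteExpander.f8])
      (fun _ hv t => BipartiteExpander.f8_mul hv t)
      (fun _ _ => BipartiteExpander.f8_dual) (fun _ => BipartiteExpander.le_f8)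
      BipartiteExpander.exists_perm_f8
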